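/- A permutation is a bijection $\pi:[n]\to[n]$ with $n\ge 0$ (the empty permutation is included). The pattern of a set of elements of $\pi$ is the permutation with the same relative order in position and in value; $\sigma$ is contained in $\pi$ if $\sigma$ is the pattern of some set of elements of $\pi$. A (permutation) class is a set of permutations closed downwards under containment, a subclass of a class is a class contained in it, and $\mathrm{Av}(\sigma)$ is the class of permutations not containing $\sigma$. Let $\mathsf{Sep}$ be the class of separable permutations, i.e. the smallest class that contains the permutation $1$ and is closed under sums $\oplus$ and skew sums $\ominus$. For $\sigma$ of size $k$, the inflation $\sigma[\tau_1,\dots,\tau_k]$ is obtained from $\sigma$ by replacing, for each $i$, the $i$-th element by an interval with pattern $\tau_i$ (possibly empty); for classes $C,D$, let $C[D]$ be the class of all inflations of a permutation in $C$ by permutations in $D$. Let $\mathsf{I}$ and $\mathsf{D}$ be the classes of increasing and of decreasing permutations, and let $\mathsf{U}$ be the class consisting of the permutation $1$ and the empty permutation. A class is representable if it is of the form $X_1[X_2[\cdots[X_n]\cdots]]$ with $n\ge 0$ and each $X_i\in\{\mathsf{I},\mathsf{D},\mathrm{Av}(132),\mathrm{Av}(213),\mathrm{Av}(231),\mathrm{Av}(312)\}$,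 where for $n=0$ the class is $\mathsf{U}$. The merge $C_1\odot\cdots\odot C_k$ of classes is the class of all permutations whose elements can be coloured with $k$ colours such that, for each $i$, the pattern of the elements of colour $i$ belongs to $C_i$ (for $k=0$ it consists of the empty permutation only). For a set $A$ of classes, a class $X$ is $A$-splittable if $X\subseteq C_1\odot\cdots\odot C_k$ for some finite sequence $C_1,\dots,C_k$ ($k\ge 0$, repetitions allowed) of members of $A$. Theorem. Let $A$ be any set of representable classes, and let $B$ be the set of those classes that are minimal with respect to inclusion among the representable classes not contained in any member of $A$. Then $B$ is finite, and a proper subclass $X$ of $\mathsf{Sep}$ is $A$-splittable if and only if no element of $B$ is a subclass of $X$. -/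

import Mathlib

namespace PermPattern

/-- A permutation of arbitrary finite size `n`, i.e. a bijection of the `n`-element ordered set
`Fin n`; the empty permutation (`n = 0`) is included. -/
structure Permutation where
  size : ℕ
  perm : Equiv.Perm (Fin size)

/-- `σ` is the pattern of the elements of `π` at the positions in `S`: there is a bijection from
the elements of `σ` onto `S` preserving the positional order and the value order. -/
def HasPattern (π : Permutation) (S : Set (Fin π.size)) (σ : Permutation) : Prop :=
  ∃ f : Fin σ.size ↪o Fin π.size, Set.range f = S ∧
    ∀ i j, σ.perm i < σ.perm j ↔ π.perm (f i) < π.perm (f j)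

/-- Containment order: `σ ≤ π` if `σ` is the pattern of some set of elements of `π`. -/
instance : Preorder Permutation where
  le σ π := ∃ S, HasPattern π S σ
  le_refl π := ⟨_, RelEmbedding.refl _, rfl, fun _ _ => Iff.rfl⟩
  le_trans := by
    rintro σ τ π ⟨_, f, -, hf⟩ ⟨_, g, -, hg⟩
    exact ⟨_, f.trans g, rfl, fun i j => (hf i j).trans (hg (f i) (f j))⟩

/-- A permutation class: a set of permutations closed downwards under containment. -/
def IsPermClass (C : Set Permutation) : Prop := IsLowerSet C

/-- The permutations that avoid `σ`. -/
def Av (σ : Permutation) : Set Permutation := {π | ¬ σ ≤ π}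

/-- The empty permutation. -/
def emptyPerm : Permutation := ⟨0, Equiv.refl _⟩

/-- The permutation `1` of size one. -/
def onePerm : Permutation := ⟨1, Equiv.refl _⟩

/-- The sum `σ ⊕ τ`: `τ` is placed above and to the right of `σ`. -/
def sum (σ τ : Permutation) : Permutation :=
  ⟨σ.size + τ.size,
    finSumFinEquiv.symm.trans ((Equiv.sumCongr σ.perm τ.perm).trans finSumFinEquiv)⟩

/-- The skew sum `σ ⊖ τ`: `τ` is placed below and to the right of `σ`. -/
def skewSum (σ τ : Permutation) : Permutation :=
  ⟨σ.size + τ.size,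
    finSumFinEquiv.symm.trans ((Equiv.sumCongr σ.perm τ.perm).trans
      ((Equiv.sumComm _ _).trans (finSumFinEquiv.trans (finCongr (Nat.add_comm _ _)))))⟩

/-- Separable permutations: the smallest set of permutations that contains the empty permutation
and `1` and is closed under sums and skew sums. -/
inductive IsSeparable : Permutation → Prop
  | empty : IsSeparable emptyPerm
  | one : IsSeparable onePerm
  | sum {σ τ : Permutation} : IsSeparable σ → IsSeparable τ → IsSeparable (sum σ τ)
  | skewSum {σ τ : Permutation} : IsSeparable σ → IsSeparable τ → IsSeparable (skewSum σ τ)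

/-- The class of separable permutations. -/
def Sep : Set Permutation := {π | IsSeparable π}

/-- `π = σ[τ₁, …, τₖ]`: the elements of `π` are divided into blocks indexed by the elements of
`σ` (`b p` is the block of the position `p`), the block of index `m` has the pattern `τ m`, and
two different blocks are related in position and in value as the corresponding elements of `σ`.
Empty blocks (where `τ m` is empty) are allowed. -/
def IsInflation (π σ : Permutation) (τ : Fin σ.size → Permutation) : Prop :=
  ∃ b : Fin π.size → Fin σ.size,
    Monotone b ∧
    (∀ p q, b p ≠ b q → (π.perm p < π.perm q ↔ σ.perm (b p) < σ.perm (b q))) ∧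
    ∀ m, HasPattern π (b ⁻¹' {m}) (τ m)

/-- The inflation `C[D]` of classes. -/
def inflation (C D : Set Permutation) : Set Permutation :=
  {π | ∃ σ ∈ C, ∃ τ : Fin σ.size → Permutation, (∀ m, τ m ∈ D) ∧ IsInflation π σ τ}

/-- The merge `C₁ ⊙ ⋯ ⊙ Cₖ`: the permutations whose elements can be coloured with `k` colours so
that for each `i` the pattern of the elements of colour `i` belongs to `Cᵢ`. The merge of the
empty sequence consists of the empty permutation only. -/
def merge {k : ℕ} (C : Fin k → Set Permutation) : Set Permutation :=
  {π | ∃ c : Fin π.size → Fin k, ∀ i, ∃ τ ∈ C i, HasPattern π (c ⁻¹' {i}) τ}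

/-- `X` is `A`-splittable: it is contained in the merge of a finite sequence of members of `A`. -/
def Splittable (A : Set (Set Permutation)) (X : Set Permutation) : Prop :=
  ∃ (k : ℕ) (C : Fin k → Set Permutation), (∀ i, C i ∈ A) ∧ X ⊆ merge C

/-- The class containing only the permutation `1` and the empty permutation. -/
def unitClass : Set Permutation := {π | π.size ≤ 1}

/-- The class of increasing permutations. -/
def increasing : Set Permutation := {π | StrictMono π.perm}

/-- The class of decreasing permutations. -/
def decreasing : Set Permutation := {π | StrictAnti π.perm}

/-- The permutation `132` (in one-line notation; here positions and values start from `0`). -/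
def perm132 : Permutation := ⟨3, ⟨![0, 2, 1], ![0, 2, 1], by decide, by decide⟩⟩

/-- The permutation `213`. -/
def perm213 : Permutation := ⟨3, ⟨![1, 0, 2], ![1, 0, 2], by decide, by decide⟩⟩

/-- The permutation `231`. -/
def perm231 : Permutation := ⟨3, ⟨![1, 2, 0], ![2, 0, 1], by decide, by decide⟩⟩

/-- The permutation `312`. -/
def perm312 : Permutation := ⟨3, ⟨![2, 0, 1], ![1, 2, 0], by decide, by decide⟩⟩

/-- The six classes from which the representable classes are built. -/
def alphabet : Set (Set Permutation) :=
  {increasing, decreasing, Av perm132, Av perm213, Av perm231, Av perm312}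

/-- The class `X₁[X₂[⋯[Xₙ]⋯]]` represented by a word `X₁X₂⋯Xₙ` of classes; the empty word
represents the class `unitClass`, the unit element for inflation. -/
def classOfWord (w : List (Set Permutation)) : Set Permutation := w.foldr inflation unitClass

/-- A class is representable if it is represented by a word over the alphabet of the six
classes. -/
def Representable (C : Set Permutation) : Prop :=
  ∃ w : List (Set Permutation), (∀ L ∈ w, L ∈ alphabet) ∧ C = classOfWord w

/-- The set `B`: the minimal elements, with respect to inclusion, among the representable classes
that are not contained in any member of `A`. -/
def minimalUncovered (A : Set (Set Permutation)) : Set (Set Permutation) :=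
  {R | Minimal (fun R => Representable R ∧ ∀ C ∈ A, ¬ R ⊆ C) R}

end PermPattern

/-!
The argument has three ingredients, all of which treat sums and skew sums alike, as `comb s`.

*Construction of representable classes.* By `inflation_letterClass`, the inflations of members of
one of the six classes by members of `K` are the permutations obtained from the empty one by
attaching members of `K` by a sum or a skew sum on a fixed side and, for the four classes
`Av(132)`, …, joining two such permutations by the opposite operation. The last element attached is
the one that is extreme in value. All statements below about representable classes are proved by
induction on this construction, where only the monotonicity of `comb s` is needed, together with the
fact that a colouring of `comb s x y` amounts to colourings of `x` and of `y`.

*Representable classes are Ramsey.* In a representable class `R`, for all `σ` and `τ` some member of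
`R` has a red copy of `σ` or a blue copy of `τ` in each colouring (`exists_arrows`). So if `R` is
contained in a merge of classes, it is contained in one of them (`exists_subset_of_subset_merge`),
which shows that a class containing a member of `B = minimalUncovered A` is not `A`-splittable.

*Proper subclasses split.* If a separable `π` avoids `comb s γ δ`, then at each node `comb s x y` of
its decomposition `x` avoids `γ` or `y` avoids `δ`. Collecting the parts of both kinds, `π` is a
merge of two inflations, by permutations avoiding `γ` and `δ` respectively, and by induction on the
avoided permutation a proper subclass of `Sep` is contained in a merge of representable classes
(`IsSeparable.exists_splits`). Likewise the members of a representable class that avoid some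
member of it are contained in a merge of simpler representable classes, where in the word either a
letter `I` or `D` is deleted or one of the other letters is replaced by at most two letters `I`, `D`
(`exists_splits_of_mem_wordClass`). Iterating, a proper subclass `X` of `Sep` is contained in a
merge of representable classes *contained in* `X` (`exists_splits_of_ssubset_sep`). If `X` contains
no member of `B`, each of these lies in a member of `A`, since by Higman's lemma inclusion of
representable classes is a well-quasi-order (`wellQuasiOrdered_wordClass`), so that below each
uncovered class there is a minimal one. Higman's lemma also shows that `B` is finite.
-/

namespace PermPattern

/-! ### Patterns of sets of elements -/

theorem HasPattern.le {π σ : Permutation} {S : Set (Fin π.size)} (h : HasPattern π S σ) : σ ≤ π :=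
  ⟨S, h⟩

theorem HasPattern.le_of_subset {π σ τ : Permutation} {S T : Set (Fin π.size)}
    (hσ : HasPattern π S σ) (hτ : HasPattern π T τ) (h : S ⊆ T) : σ ≤ τ := by
  obtain ⟨f, rfl, hf⟩ := hσ
  obtain ⟨g, rfl, hg⟩ := hτ
  choose e he using fun i => h ⟨i, rfl⟩
  have hmono : StrictMono e := fun i j hij => by
    rw [← g.lt_iff_lt, he, he]
    exact f.strictMono hij
  refine HasPattern.le ⟨OrderEmbedding.ofStrictMono e hmono, rfl, fun i j => ?_⟩
  rw [hf, ← he, ← he, ← hg]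
  rfl

/-- The pattern of a subset of a copy of `σ` in `π`. -/
theorem HasPattern.trans {π σ τ : Permutation} {S : Set (Fin σ.size)} {e : Fin σ.size ↪o Fin π.size}
    (h : HasPattern σ S τ) (he : ∀ i j, σ.perm i < σ.perm j ↔ π.perm (e i) < π.perm (e j)) :
    HasPattern π (e '' S) τ := by
  obtain ⟨f, rfl, hf⟩ := h
  refine ⟨f.trans e, ?_, fun i j => (hf i j).trans (he _ _)⟩
  rw [← Set.range_comp]
  rfl

theorem hasPattern_univ (π : Permutation) : HasPattern π Set.univ π :=
  ⟨RelEmbedding.refl _, by ext; simp, fun _ _ => Iff.rfl⟩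

theorem hasPattern_empty (π : Permutation) : HasPattern π ∅ emptyPerm := by
  refine ⟨⟨⟨fun i : Fin 0 => i.elim0, fun i => i.elim0⟩, fun {i} => i.elim0⟩, ?_, fun i => i.elim0⟩
  rw [Set.range_eq_empty_iff]
  exact inferInstanceAs (IsEmpty (Fin 0))

/-- A set of elements has at most one pattern; in particular isomorphic permutations are equal. -/
theorem HasPattern.unique {π σ τ : Permutation} {S : Set (Fin π.size)} (hσ : HasPattern π S σ)
    (hτ : HasPattern π S τ) : σ = τ := by
  obtain ⟨n, p⟩ := σ
  obtain ⟨m, q⟩ := τ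
  obtain ⟨f, hf, hp⟩ := hσ
  obtain ⟨g, hg, hq⟩ := hτ
  dsimp only at f g hp hq
  have hnm : n = m := by
    have h1 := Nat.card_range_of_injective f.injective
    have h2 := Nat.card_range_of_injective g.injective
    rw [hf] at h1
    rw [hg] at h2
    simpa using h1.symm.trans h2
  subst hnm
  have hfg : (f : Fin n → Fin π.size) = g :=
    (StrictMono.range_inj f.strictMono g.strictMono).1 (hf.trans hg.symm)
  have hlt : ∀ i j, p i < p j ↔ q i < q j := fun i j => by rw [hp, hq, hfg]
  have hmono : StrictMono (p ∘ q.symm) := fun a b hab => by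
    simpa [hlt] using hab
  have hid : p ∘ q.symm = id :=
    (StrictMono.range_inj hmono strictMono_id).1 (by
      rw [(p.surjective.comp q.symm.surjective).range_eq, Set.range_id])
  have hpq : p = q := by
    ext i
    have := congrFun hid (q i)
    simp only [Function.comp_apply, Equiv.symm_apply_apply, id_eq] at this
    rw [this]
  rw [hpq]

theorem exists_hasPattern (π : Permutation) (S : Set (Fin π.size)) :
    ∃ σ, HasPattern π S σ := by
  classical
  let T := S.toFinset
  let V := T.image π.perm
  have hV : V.card = T.card := Finset.card_image_of_injective _ π.perm.injective
  let f : Fin T.card ↪o Fin π.size := T.orderEmbOfFin rfl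
  let e := V.orderIsoOfFin hV
  have hfV : ∀ i, π.perm (f i) ∈ V := fun i =>
    Finset.mem_image_of_mem _ (T.orderEmbOfFin_mem rfl i)
  let g : Fin T.card → Fin T.card := fun i => e.symm ⟨π.perm (f i), hfV i⟩
  have hg : Function.Injective g := fun i j hij => by
    have := e.symm.injective hij
    exact f.injective (π.perm.injective (Subtype.ext_iff.1 this))
  refine ⟨⟨T.card, Equiv.ofBijective g (Finite.injective_iff_bijective.1 hg)⟩, f, ?_, ?_⟩
  · rw [Finset.range_orderEmbOfFin, Set.coe_toFinset]
  · intro i j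
    simp only [Equiv.ofBijective_apply, g, OrderIso.lt_iff_lt, Subtype.mk_lt_mk]

theorem eq_emptyPerm_of_size {π : Permutation} (h : π.size = 0) : π = emptyPerm := by
  have hE : IsEmpty (Fin π.size) := by rw [h]; infer_instance
  refine (hasPattern_univ π).unique ?_
  rw [Set.univ_eq_empty_iff.2 hE]
  exact hasPattern_empty π

theorem emptyPerm_le (π : Permutation) : emptyPerm ≤ π := (hasPattern_empty π).le

theorem onePerm_le {π : Permutation} (h : 0 < π.size) : onePerm ≤ π := by
  refine HasPattern.le (S := Set.range fun _ : Fin 1 => (⟨0, h⟩ : Fin π.size))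
    ⟨⟨⟨fun _ => ⟨0, h⟩, fun (a b : Fin 1) _ => Subsingleton.elim a b⟩, ?_⟩, rfl, ?_⟩
  · intro (a : Fin 1) (b : Fin 1)
    simp [Subsingleton.elim a b]
    exact le_rfl
  · intro (a : Fin 1) (b : Fin 1)
    simp [Subsingleton.elim a b]

theorem le_onePerm {π : Permutation} (h : π.size ≤ 1) : π ≤ onePerm := by
  obtain ⟨n, p⟩ := π
  dsimp only at h
  interval_cases n
  · rw [eq_emptyPerm_of_size (π := ⟨0, p⟩) rfl]
    exact emptyPerm_le _
  · rw [Subsingleton.elim p (Equiv.refl _)]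
    exact le_refl onePerm

theorem size_le_of_le {σ π : Permutation} (h : σ ≤ π) : σ.size ≤ π.size := by
  obtain ⟨S, f, -⟩ := h
  simpa using Fintype.card_le_of_injective f f.injective

/-! ### Sums and skew sums -/

/-- The sum of two permutations if `s` is `true`, their skew sum if `s` is `false`. -/
def comb (s : Bool) (x y : Permutation) : Permutation := match s with
  | true => sum x y
  | false => skewSum x y

/-- The relation `<` if `s` is `true`, the relation `>` if `s` is `false`: how the values of the two
parts of `comb s x y` compare. -/
def slt (s : Bool) {n : ℕ} (a b : Fin n) : Prop := match s with
  | true => a < b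
  | false => b < a

theorem slt_not {s : Bool} {n : ℕ} {a b : Fin n} : slt (!s) a b ↔ slt s b a := by
  cases s <;> rfl

theorem slt_asymm {s : Bool} {n : ℕ} {a b : Fin n} (h : slt s a b) : ¬ slt s b a := by
  cases s <;> exact lt_asymm h

theorem slt_trichotomy (s : Bool) {n : ℕ} {a b : Fin n} (h : a ≠ b) : slt s a b ∨ slt s b a := by
  cases s
  · exact (lt_or_gt_of_ne h).symm
  · exact lt_or_gt_of_ne h

theorem slt_iff_slt {s : Bool} {n m : ℕ} {a b : Fin n} {c d : Fin m}
    (h : slt s a b) (h' : slt s c d) : (a < b ↔ c < d) ∧ (b < a ↔ d < c) := by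
  cases s
  · exact ⟨iff_of_false (lt_asymm h) (lt_asymm h'), iff_of_true h h'⟩
  · exact ⟨iff_of_true h h', iff_of_false (lt_asymm h) (lt_asymm h')⟩

theorem slt_congr {s : Bool} {n m : ℕ} {a b : Fin n} {c d : Fin m}
    (h : a < b ↔ c < d) (h' : b < a ↔ d < c) : slt s a b ↔ slt s c d := by
  cases s
  · exact h'
  · exact h

/-- `ρ` consists of a copy `l` of `x` followed by a copy `r` of `y`, all of whose values are larger
(if `s` is `true`) or smaller (if `s` is `false`). -/
structure IsComb (s : Bool) (ρ x y : Permutation) (l : Fin x.size ↪o Fin ρ.size)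
    (r : Fin y.size ↪o Fin ρ.size) : Prop where
  cover : ∀ p, (∃ i, p = l i) ∨ ∃ j, p = r j
  lt : ∀ i j, l i < r j
  left : ∀ i j, x.perm i < x.perm j ↔ ρ.perm (l i) < ρ.perm (l j)
  right : ∀ i j, y.perm i < y.perm j ↔ ρ.perm (r i) < ρ.perm (r j)
  slt : ∀ i j, slt s (ρ.perm (l i)) (ρ.perm (r j))

theorem sum_perm_castAdd (x y : Permutation) (i : Fin x.size) :
    ((sum x y).perm (Fin.castAdd y.size i)).val = (x.perm i).val := by
  change (finSumFinEquiv (Sum.map x.perm y.perm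
    (finSumFinEquiv.symm (Fin.castAdd y.size i)))).val = _
  rw [finSumFinEquiv_symm_apply_castAdd]
  simp

theorem sum_perm_natAdd (x y : Permutation) (j : Fin y.size) :
    ((sum x y).perm (Fin.natAdd x.size j)).val = x.size + (y.perm j).val := by
  change (finSumFinEquiv (Sum.map x.perm y.perm
    (finSumFinEquiv.symm (Fin.natAdd x.size j)))).val = _
  rw [finSumFinEquiv_symm_apply_natAdd]
  simp

theorem skewSum_perm_castAdd (x y : Permutation) (i : Fin x.size) :
    ((skewSum x y).perm (Fin.castAdd y.size i)).val = y.size + (x.perm i).val := by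
  change (finSumFinEquiv (Sum.swap (Sum.map x.perm y.perm
    (finSumFinEquiv.symm (Fin.castAdd y.size i))))).val = _
  rw [finSumFinEquiv_symm_apply_castAdd]
  simp

theorem skewSum_perm_natAdd (x y : Permutation) (j : Fin y.size) :
    ((skewSum x y).perm (Fin.natAdd x.size j)).val = (y.perm j).val := by
  change (finSumFinEquiv (Sum.swap (Sum.map x.perm y.perm
    (finSumFinEquiv.symm (Fin.natAdd x.size j))))).val = _
  rw [finSumFinEquiv_symm_apply_natAdd]
  simp

theorem exists_isComb (s : Bool) (x y : Permutation) :
    ∃ l r, IsComb s (comb s x y) x y l r := by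
  have hcover : ∀ p : Fin (x.size + y.size),
      (∃ i, p = Fin.castAdd y.size i) ∨ ∃ j, p = Fin.natAdd x.size j := fun p =>
    Fin.addCases (fun i => Or.inl ⟨i, rfl⟩) (fun j => Or.inr ⟨j, rfl⟩) p
  have hlt : ∀ i j, Fin.castAdd y.size i < Fin.natAdd x.size j := fun i j => by
    rw [Fin.lt_def, Fin.val_castAdd, Fin.val_natAdd]
    omega
  cases s
  · have hl := skewSum_perm_castAdd x y
    have hr := skewSum_perm_natAdd x y
    refine ⟨Fin.castAddOrderEmb y.size, Fin.natAddOrderEmb x.size, hcover, hlt,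
      fun i j => ?_, fun i j => ?_, fun i j => ?_⟩
    · exact Fin.lt_def.trans (by rw [← Nat.add_lt_add_iff_left (k := y.size), ← hl, ← hl]; rfl)
    · exact Fin.lt_def.trans (by rw [← hr, ← hr]; rfl)
    · refine Fin.lt_def.2 ((hr j).trans_lt (lt_of_lt_of_eq ?_ (hl i).symm))
      omega
  · have hl := sum_perm_castAdd x y
    have hr := sum_perm_natAdd x y
    refine ⟨Fin.castAddOrderEmb y.size, Fin.natAddOrderEmb x.size, hcover, hlt,
      fun i j => ?_, fun i j => ?_, fun i j => ?_⟩
    · exact Fin.lt_def.trans (by rw [← hl, ← hl]; rfl)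
    · exact Fin.lt_def.trans (by rw [← Nat.add_lt_add_iff_left (k := x.size), ← hr, ← hr]; rfl)
    · refine Fin.lt_def.2 ((hl i).trans_lt (lt_of_lt_of_eq ?_ (hr j).symm))
      omega

namespace IsComb

variable {s : Bool} {ρ x y : Permutation} {l : Fin x.size ↪o Fin ρ.size}
  {r : Fin y.size ↪o Fin ρ.size}

theorem hasPattern_image_left (h : IsComb s ρ x y l r) {S : Set (Fin x.size)} {σ : Permutation}
    (hS : HasPattern x S σ) : HasPattern ρ (l '' S) σ :=
  hS.trans h.left

theorem hasPattern_image_right (h : IsComb s ρ x y l r) {S : Set (Fin y.size)} {σ : Permutation}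
    (hS : HasPattern y S σ) : HasPattern ρ (r '' S) σ :=
  hS.trans h.right

/-- Functions on the two parts glue to a function on the whole. -/
theorem exists_glue (h : IsComb s ρ x y l r) {ι : Type*} (a : Fin x.size → ι)
    (b : Fin y.size → ι) : ∃ c : Fin ρ.size → ι, (∀ i, c (l i) = a i) ∧ ∀ j, c (r j) = b j := by
  have hex : ∀ p, ∃ k : ι, (∀ i, p = l i → k = a i) ∧ ∀ j, p = r j → k = b j := by
    intro p
    obtain ⟨i, rfl⟩ | ⟨j, rfl⟩ := h.cover p
    · exact ⟨a i, fun i' hi => by rw [l.injective hi],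
        fun j hj => absurd hj (h.lt i j).ne⟩
    · exact ⟨b j, fun i hi => absurd hi (h.lt i j).ne',
        fun j' hj => by rw [r.injective hj]⟩
  choose c hl hr using hex
  exact ⟨c, fun i => hl _ i rfl, fun j => hr _ j rfl⟩

theorem preimage_eq (h : IsComb s ρ x y l r) {ι : Type*} {c : Fin ρ.size → ι}
    (S : Set ι) : c ⁻¹' S = l '' ((c ∘ l) ⁻¹' S) ∪ r '' ((c ∘ r) ⁻¹' S) := by
  ext p
  constructor
  · intro hp
    obtain ⟨i, rfl⟩ | ⟨j, rfl⟩ := h.cover p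
    · exact Or.inl ⟨i, hp, rfl⟩
    · exact Or.inr ⟨j, hp, rfl⟩
  · rintro (⟨i, hi, rfl⟩ | ⟨j, hj, rfl⟩)
    · exact hi
    · exact hj

end IsComb

/-- If `T` lies to the right of `S` and above it (below it if `s` is `false`), then the pattern of
`S ∪ T` is the sum (the skew sum) of the patterns of `S` and `T`. -/
theorem HasPattern.union {π σ τ : Permutation} {S T : Set (Fin π.size)} {s : Bool}
    (hS : HasPattern π S σ) (hT : HasPattern π T τ)
    (h : ∀ p ∈ S, ∀ q ∈ T, p < q ∧ slt s (π.perm p) (π.perm q)) :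
    HasPattern π (S ∪ T) (comb s σ τ) := by
  obtain ⟨f, rfl, hf⟩ := hS
  obtain ⟨g, rfl, hg⟩ := hT
  obtain ⟨l, r, hc⟩ := exists_isComb s σ τ
  obtain ⟨e, hl, hr⟩ := hc.exists_glue f g
  have h' : ∀ i j, f i < g j ∧ PermPattern.slt s (π.perm (f i)) (π.perm (g j)) :=
    fun i j => h _ ⟨i, rfl⟩ _ ⟨j, rfl⟩
  have he : StrictMono e := by
    intro p q hpq
    obtain ⟨i, rfl⟩ | ⟨i, rfl⟩ := hc.cover p <;> obtain ⟨j, rfl⟩ | ⟨j, rfl⟩ := hc.cover q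
    · rw [hl, hl]
      exact f.strictMono (l.lt_iff_lt.1 hpq)
    · rw [hl, hr]
      exact (h' i j).1
    · exact absurd hpq (lt_asymm (hc.lt j i))
    · rw [hr, hr]
      exact g.strictMono (r.lt_iff_lt.1 hpq)
  refine ⟨OrderEmbedding.ofStrictMono e he, ?_, ?_⟩
  · ext p
    simp only [OrderEmbedding.coe_ofStrictMono]
    constructor
    · rintro ⟨q, rfl⟩
      obtain ⟨i, rfl⟩ | ⟨i, rfl⟩ := hc.cover q
      · exact Or.inl ⟨i, (hl i).symm⟩
      · exact Or.inr ⟨i, (hr i).symm⟩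
    · rintro (⟨i, rfl⟩ | ⟨i, rfl⟩)
      · exact ⟨_, hl i⟩
      · exact ⟨_, hr i⟩
  · intro p q
    simp only [OrderEmbedding.coe_ofStrictMono]
    obtain ⟨i, rfl⟩ | ⟨i, rfl⟩ := hc.cover p <;> obtain ⟨j, rfl⟩ | ⟨j, rfl⟩ := hc.cover q
    · rw [hl, hl, ← hc.left, hf]
    · rw [hl, hr]
      exact (slt_iff_slt (hc.slt i j) (h' i j).2).1
    · rw [hl, hr]
      exact (slt_iff_slt (hc.slt j i) (h' j i).2).2
    · rw [hr, hr, ← hc.right, hg]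

theorem IsComb.hasPattern_union {s : Bool} {ρ x y σ τ : Permutation} {l : Fin x.size ↪o Fin ρ.size}
    {r : Fin y.size ↪o Fin ρ.size} (h : IsComb s ρ x y l r) {S : Set (Fin x.size)}
    {T : Set (Fin y.size)} (hS : HasPattern x S σ) (hT : HasPattern y T τ) :
    HasPattern ρ (l '' S ∪ r '' T) (comb s σ τ) := by
  refine (h.hasPattern_image_left hS).union (h.hasPattern_image_right hT) ?_
  rintro _ ⟨i, -, rfl⟩ _ ⟨j, -, rfl⟩
  exact ⟨h.lt i j, h.slt i j⟩

theorem le_comb_left (s : Bool) (x y : Permutation) : x ≤ comb s x y := by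
  obtain ⟨l, r, h⟩ := exists_isComb s x y
  exact (h.hasPattern_image_left (hasPattern_univ x)).le

theorem le_comb_right (s : Bool) (x y : Permutation) : y ≤ comb s x y := by
  obtain ⟨l, r, h⟩ := exists_isComb s x y
  exact (h.hasPattern_image_right (hasPattern_univ y)).le

theorem comb_mono (s : Bool) {x y x' y' : Permutation} (hx : x ≤ x') (hy : y ≤ y') :
    comb s x y ≤ comb s x' y' := by
  obtain ⟨S, hS⟩ := hx
  obtain ⟨T, hT⟩ := hy
  obtain ⟨l, r, h⟩ := exists_isComb s x' y'
  exact (h.hasPattern_union hS hT).le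

theorem exists_of_le_comb {s : Bool} {σ x y : Permutation} (h : σ ≤ comb s x y) :
    ∃ x' y', x' ≤ x ∧ y' ≤ y ∧ σ = comb s x' y' := by
  obtain ⟨S, hS⟩ := h
  obtain ⟨l, r, h⟩ := exists_isComb s x y
  obtain ⟨x', hx⟩ := exists_hasPattern x (l ⁻¹' S)
  obtain ⟨y', hy⟩ := exists_hasPattern y (r ⁻¹' S)
  refine ⟨x', y', hx.le, hy.le, hS.unique ?_⟩
  have hpre := h.preimage_eq (c := id) S
  rw [Set.preimage_id] at hpre
  rw [hpre]
  exact h.hasPattern_union hx hy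

theorem comb_empty_right (s : Bool) (x : Permutation) : comb s x emptyPerm = x := by
  have h := (hasPattern_univ x).union (s := s) (hasPattern_empty x) (by simp)
  rw [Set.union_empty] at h
  exact h.unique (hasPattern_univ x)

theorem comb_empty_left (s : Bool) (x : Permutation) : comb s emptyPerm x = x := by
  have h := (hasPattern_empty x).union (s := s) (hasPattern_univ x) (by simp)
  rw [Set.empty_union] at h
  exact h.unique (hasPattern_univ x)

/-! ### Colourings -/

/-- The elements of `π` can be coloured with the colours `ι` so that the elements of colour `i`
have the pattern `f i`, for each `i`. -/
def Coloured {ι : Type*} (π : Permutation) (f : ι → Permutation) : Prop :=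
  ∃ c : Fin π.size → ι, ∀ i, HasPattern π (c ⁻¹' {i}) (f i)

theorem mem_merge_iff {k : ℕ} {C : Fin k → Set Permutation} {π : Permutation} :
    π ∈ merge C ↔ ∃ f, Coloured π f ∧ ∀ i, f i ∈ C i := by
  constructor
  · rintro ⟨c, hc⟩
    choose f hf hp using hc
    exact ⟨f, ⟨c, hp⟩, hf⟩
  · rintro ⟨f, ⟨c, hc⟩, hf⟩
    exact ⟨c, fun i => ⟨f i, hf i, hc i⟩⟩

namespace Coloured

variable {ι κ : Type*} {π : Permutation}

theorem le {f : ι → Permutation} (h : Coloured π f) (i : ι) : f i ≤ π :=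
  h.choose_spec i |>.le

/-- Colourings of the two summands glue to a colouring of a sum. -/
theorem comb {s : Bool} {x y : Permutation} {f g : ι → Permutation} (hf : Coloured x f)
    (hg : Coloured y g) : Coloured (comb s x y) fun i => PermPattern.comb s (f i) (g i) := by
  obtain ⟨a, ha⟩ := hf
  obtain ⟨b, hb⟩ := hg
  obtain ⟨l, r, h⟩ := exists_isComb s x y
  obtain ⟨c, hl, hr⟩ := h.exists_glue a b
  refine ⟨c, fun i => ?_⟩
  rw [h.preimage_eq, show c ∘ l = a from funext hl, show c ∘ r = b from funext hr]
  exact h.hasPattern_union (ha i) (hb i)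

/-- A colouring of a sum comes from colourings of the two summands. -/
theorem exists_of_comb {s : Bool} {x y : Permutation} {f : ι → Permutation}
    (hf : Coloured (PermPattern.comb s x y) f) :
    ∃ f₁ f₂, Coloured x f₁ ∧ Coloured y f₂ ∧ ∀ i, f i = PermPattern.comb s (f₁ i) (f₂ i) := by
  obtain ⟨c, hc⟩ := hf
  obtain ⟨l, r, h⟩ := exists_isComb s x y
  choose f₁ h₁ using fun i => exists_hasPattern x ((c ∘ l) ⁻¹' {i})
  choose f₂ h₂ using fun i => exists_hasPattern y ((c ∘ r) ⁻¹' {i})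
  refine ⟨f₁, f₂, ⟨_, h₁⟩, ⟨_, h₂⟩, fun i => (hc i).unique ?_⟩
  rw [h.preimage_eq]
  exact h.hasPattern_union (h₁ i) (h₂ i)

theorem unit (π : Permutation) : Coloured π fun _ : Unit => π := by
  refine ⟨fun _ => (), fun _ => ?_⟩
  convert hasPattern_univ π
  exact Set.eq_univ_of_forall fun _ => rfl

/-- The empty permutation can be coloured with any, possibly empty, set of colours. -/
theorem empty : Coloured emptyPerm fun _ : ι => emptyPerm := by
  refine ⟨fun i : Fin 0 => i.elim0, fun i => ?_⟩
  convert hasPattern_empty emptyPerm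
  ext (p : Fin 0)
  exact p.elim0

theorem inl {f : ι → Permutation} (h : Coloured π f) :
    Coloured π (Sum.elim f fun _ : κ => emptyPerm) := by
  obtain ⟨c, hc⟩ := h
  refine ⟨Sum.inl ∘ c, Sum.rec (fun i => ?_) fun j => ?_⟩
  · rw [show (Sum.inl ∘ c : Fin π.size → ι ⊕ κ) ⁻¹' {Sum.inl i} = c ⁻¹' {i} by ext; simp]
    exact hc i
  · rw [show (Sum.inl ∘ c : Fin π.size → ι ⊕ κ) ⁻¹' {Sum.inr j} = ∅ by ext; simp]
    exact hasPattern_empty π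

theorem inr {f : ι → Permutation} (h : Coloured π f) :
    Coloured π (Sum.elim (fun _ : κ => emptyPerm) f) := by
  obtain ⟨c, hc⟩ := h
  refine ⟨Sum.inr ∘ c, Sum.rec (fun j => ?_) fun i => ?_⟩
  · rw [show (Sum.inr ∘ c : Fin π.size → κ ⊕ ι) ⁻¹' {Sum.inl j} = ∅ by ext; simp]
    exact hasPattern_empty π
  · rw [show (Sum.inr ∘ c : Fin π.size → κ ⊕ ι) ⁻¹' {Sum.inr i} = c ⁻¹' {i} by ext; simp]
    exact hc i

/-- The colours may be renamed. -/
theorem comp_symm {f : ι → Permutation} (h : Coloured π f) (e : ι ≃ κ) :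
    Coloured π (f ∘ e.symm) := by
  obtain ⟨c, hc⟩ := h
  refine ⟨e ∘ c, fun i => ?_⟩
  rw [show (e ∘ c) ⁻¹' {i} = c ⁻¹' {e.symm i} by ext; simp [Equiv.eq_symm_apply]]
  exact hc _

/-- The elements of each colour can be coloured anew. -/
theorem sigma {κ : ι → Type*} {f : ι → Permutation} {g : ∀ i, κ i → Permutation}
    (hf : Coloured π f) (hg : ∀ i, Coloured (f i) (g i)) :
    Coloured π fun k : Σ i, κ i => g k.1 k.2 := by
  obtain ⟨c, hc⟩ := hf
  choose e he hlt using hc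
  choose d hd using hg
  have hex : ∀ p, ∃ q, e (c p) q = p := fun p => by
    have : p ∈ Set.range (e (c p)) := by
      rw [he]
      rfl
    exact this
  choose q hq using hex
  have hcq : ∀ p i (t : Fin (f i).size), e i t = p →
      (⟨c p, d (c p) (q p)⟩ : Σ i, κ i) = ⟨i, d i t⟩ := by
    intro p i t hp
    have hi : p ∈ c ⁻¹' {i} := by
      rw [← he]
      exact ⟨t, hp⟩
    obtain rfl : c p = i := hi
    rw [(e (c p)).injective ((hq p).trans hp.symm)]
  refine ⟨fun p => ⟨c p, d (c p) (q p)⟩, ?_⟩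
  rintro ⟨i, j⟩
  convert (hd i j).trans (hlt i) using 1
  ext p
  symm
  constructor
  · rintro ⟨t, rfl, rfl⟩
    exact hcq _ i t rfl
  · rintro h
    obtain ⟨rfl, h2⟩ := Sigma.mk.inj_iff.1 h
    exact ⟨q p, eq_of_heq h2, hq p⟩

/-- A colouring of a permutation restricts to the permutations contained in it. -/
theorem exists_of_le {σ : Permutation} {f : ι → Permutation} (hf : Coloured π f) (h : σ ≤ π) :
    ∃ f', Coloured σ f' ∧ ∀ i, f' i ≤ f i := by
  obtain ⟨c, hc⟩ := hf
  obtain ⟨_, e, rfl, he⟩ := h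
  choose f' hf' using fun i => exists_hasPattern σ ((c ∘ e) ⁻¹' {i})
  refine ⟨f', ⟨_, hf'⟩, fun i => ?_⟩
  refine HasPattern.le_of_subset ((hf' i).trans he) (hc i) ?_
  rintro _ ⟨p, hp, rfl⟩
  exact hp

end Coloured

/-- In a colouring with the colours `0, …, k`, the colours other than `0` may be identified. -/
theorem Coloured.exists_cons {π : Permutation} {k : ℕ} {f : Fin (k + 1) → Permutation}
    (hf : Coloured π f) : ∃ g, (Coloured π fun i : Bool => bif i then f 0 else g) ∧
      Coloured g fun i : Fin k => f i.succ := by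
  obtain ⟨c, hc⟩ := hf
  obtain ⟨g, hg⟩ := exists_hasPattern π (c ⁻¹' {0}ᶜ)
  refine ⟨g, ⟨fun p => decide (c p = 0), ?_⟩, ?_⟩
  · rintro (_ | _)
    · rw [show (fun p => decide (c p = 0)) ⁻¹' {false} = c ⁻¹' {0}ᶜ by ext; simp]
      exact hg
    · rw [show (fun p => decide (c p = 0)) ⁻¹' {true} = c ⁻¹' {0} by ext; simp]
      exact hc 0
  · obtain ⟨e, he, hlt⟩ := hg
    have hne : ∀ q, c (e q) ≠ 0 := fun q => by
      have : e q ∈ c ⁻¹' {0}ᶜ := he ▸ ⟨q, rfl⟩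
      exact this
    refine ⟨fun q => (c (e q)).pred (hne q), fun i => ?_⟩
    obtain ⟨σ, hσ⟩ := exists_hasPattern g ((fun q => (c (e q)).pred (hne q)) ⁻¹' {i})
    have hσ' := hσ.trans hlt
    have himage : e '' ((fun q => (c (e q)).pred (hne q)) ⁻¹' {i}) = c ⁻¹' {i.succ} := by
      ext p
      constructor
      · rintro ⟨q, hq, rfl⟩
        exact (Fin.pred_eq_iff_eq_succ _).1 hq
      · intro hp
        have hp' : p ∈ Set.range e := by
          rw [he]
          exact fun h0 => Fin.succ_ne_zero i ((Set.mem_singleton_iff.1 hp).symm.trans h0)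
        obtain ⟨q, rfl⟩ := hp'
        exact ⟨q, (Fin.pred_eq_iff_eq_succ _).2 hp, rfl⟩
    rw [himage] at hσ'
    change HasPattern g _ (f i.succ)
    rwa [(hc _).unique hσ']


/-! ### The six classes and inflation by them -/

/-- Names for the classes of the alphabet, by the way their members are built. Elements `b` are
attached to a permutation `x`, in front of it if `left` and behind it otherwise, by sums if `s` and
by skew sums otherwise; if `br` (for branching), then permutations may also be joined by the
opposite operation. The two non-branching classes have two names each, as the side on which elements
are attached does not matter. -/
structure Letter where
  s : Bool
  left : Bool
  br : Bool

instance : Finite Letter :=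
  Finite.of_injective (fun L : Letter => (L.s, L.left, L.br)) (by
    rintro ⟨a, b, c⟩ ⟨a', b', c'⟩ h
    simpa using h)

/-- The class of the alphabet named by a letter. -/
def letterClass : Letter → Set Permutation
  | ⟨true, _, false⟩ => increasing
  | ⟨false, _, false⟩ => decreasing
  | ⟨true, false, true⟩ => Av perm132
  | ⟨true, true, true⟩ => Av perm213
  | ⟨false, false, true⟩ => Av perm312
  | ⟨false, true, true⟩ => Av perm231

/-- The permutation `b` attached to `x` as the letter `L` prescribes. -/
def attach (L : Letter) (x b : Permutation) : Permutation :=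
  match L.left with
  | true => comb L.s b x
  | false => comb L.s x b

/-- The permutations built by attaching members of `K` as the letter `L` prescribes. They turn out
to be the inflations of members of `letterClass L` by members of `K`. -/
inductive Gen (L : Letter) (K : Set Permutation) : Permutation → Prop
  | empty : Gen L K emptyPerm
  | attach {x b : Permutation} : Gen L K x → b ∈ K → Gen L K (attach L x b)
  | join {x y : Permutation} : L.br = true → Gen L K x → Gen L K y → Gen L K (comb (!L.s) x y)

theorem le_attach_left (L : Letter) (x b : Permutation) : x ≤ attach L x b := by
  unfold attach
  cases L.left
  · exact le_comb_left _ _ _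
  · exact le_comb_right _ _ _

theorem attach_mono (L : Letter) {x x' b b' : Permutation} (hx : x ≤ x') (hb : b ≤ b') :
    attach L x b ≤ attach L x' b' := by
  unfold attach
  cases L.left
  · exact comb_mono _ hx hb
  · exact comb_mono _ hb hx

theorem attach_empty_left (L : Letter) (b : Permutation) : attach L emptyPerm b = b := by
  unfold attach
  cases L.left
  · exact comb_empty_left _ _
  · exact comb_empty_right _ _

theorem attach_empty_right (L : Letter) (x : Permutation) : attach L x emptyPerm = x := by
  unfold attach
  cases L.left
  · exact comb_empty_right _ _
  · exact comb_empty_left _ _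

theorem Coloured.attach {ι : Type*} {L : Letter} {x b : Permutation} {f g : ι → Permutation}
    (hf : Coloured x f) (hg : Coloured b g) :
    Coloured (attach L x b) fun i => PermPattern.attach L (f i) (g i) := by
  unfold PermPattern.attach
  cases L.left
  · exact hf.comb hg
  · exact hg.comb hf

theorem Coloured.exists_of_attach {ι : Type*} {L : Letter} {x b : Permutation}
    {f : ι → Permutation} (hf : Coloured (PermPattern.attach L x b) f) :
    ∃ f₁ f₂, Coloured x f₁ ∧ Coloured b f₂ ∧ ∀ i, f i = PermPattern.attach L (f₁ i) (f₂ i) := by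
  obtain ⟨s, left, br⟩ := L
  cases left
  · exact Coloured.exists_of_comb (s := s) hf
  · obtain ⟨f₁, f₂, h₁, h₂, h⟩ := Coloured.exists_of_comb (s := s) hf
    exact ⟨f₂, f₁, h₂, h₁, h⟩

theorem Gen.of_mem {L : Letter} {K : Set Permutation} {b : Permutation} (hb : b ∈ K) :
    Gen L K b := by
  rw [← attach_empty_left L b]
  exact Gen.empty.attach hb

theorem Gen.mono {L : Letter} {K K' : Set Permutation} (h : K ⊆ K') {π : Permutation}
    (hπ : Gen L K π) : Gen L K' π := by
  induction hπ with
  | empty => exact .empty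
  | attach _ hb ih => exact ih.attach (h hb)
  | join hbr _ _ ih₁ ih₂ => exact .join hbr ih₁ ih₂

/-- Membership in `letterClass L`, written uniformly in the letters. -/
def Shape (L : Letter) (π : Permutation) : Prop :=
  match L.br, L.left with
  | false, _ => ∀ i j, i < j → slt L.s (π.perm i) (π.perm j)
  | true, false => ∀ i j k, i < j → j < k → slt L.s (π.perm i) (π.perm j) →
      slt L.s (π.perm i) (π.perm k) → slt L.s (π.perm j) (π.perm k)
  | true, true => ∀ i j k, i < j → j < k → slt L.s (π.perm j) (π.perm k) →
      slt L.s (π.perm i) (π.perm k) → slt L.s (π.perm i) (π.perm j)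

/-- Containment of a permutation of size three, in terms of the elements of a copy listed by
increasing value. -/
theorem size_three_le_iff (p : Equiv.Perm (Fin 3)) (π : Permutation) :
    (⟨3, p⟩ : Permutation) ≤ π ↔ ∃ i j k, i < j ∧ j < k ∧
      π.perm (![i, j, k] (p.symm 0)) < π.perm (![i, j, k] (p.symm 1)) ∧
      π.perm (![i, j, k] (p.symm 1)) < π.perm (![i, j, k] (p.symm 2)) := by
  constructor
  · rintro ⟨_, f, -, hf⟩
    dsimp only at f hf
    have hfe : ![f 0, f 1, f 2] = f := by
      ext a
      fin_cases a <;> rfl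
    refine ⟨f 0, f 1, f 2, f.strictMono (by decide), f.strictMono (by decide), ?_⟩
    rw [hfe, ← hf, ← hf]
    simp
  · rintro ⟨i, j, k, hij, hjk, h1, h2⟩
    have hf : StrictMono ![i, j, k] := by
      rw [Fin.strictMono_iff_lt_succ]
      intro a
      fin_cases a
      · exact hij
      · exact hjk
    have hg : StrictMono fun c => π.perm (![i, j, k] (p.symm c)) := by
      rw [Fin.strictMono_iff_lt_succ]
      intro a
      fin_cases a
      · exact h1
      · exact h2
    refine HasPattern.le ⟨OrderEmbedding.ofStrictMono _ hf, rfl, fun a b => ?_⟩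
    simpa using (hg.lt_iff_lt (a := p a) (b := p b)).symm

theorem mem_letterClass_iff (L : Letter) (π : Permutation) : π ∈ letterClass L ↔ Shape L π := by
  have hav : ∀ p, π ∈ Av ⟨3, p⟩ ↔ ∀ i j k, i < j → j < k →
      π.perm (![i, j, k] (p.symm 0)) < π.perm (![i, j, k] (p.symm 1)) →
      π.perm (![i, j, k] (p.symm 2)) ≤ π.perm (![i, j, k] (p.symm 1)) := by
    intro p
    rw [Av, Set.mem_ofPred_eq, size_three_le_iff]
    push Not
    rfl
  have hne : ∀ {i j}, i < j → π.perm i ≠ π.perm j := fun h => π.perm.injective.ne h.ne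
  obtain ⟨s, left, br⟩ := L
  cases br
  · cases s
    · rfl
    · rfl
  cases s <;> cases left
  · refine (hav _).trans (forall₅_congr fun i j k hij hjk => ?_)
    change (π.perm j < π.perm k → π.perm i ≤ π.perm k) ↔
      (π.perm j < π.perm i → π.perm k < π.perm i → π.perm k < π.perm j)
    have := hne hij
    have := hne hjk
    have := hne (hij.trans hjk)
    omega
  · refine (hav _).trans (forall₅_congr fun i j k hij hjk => ?_)
    change (π.perm k < π.perm i → π.perm j ≤ π.perm i) ↔
      (π.perm k < π.perm j → π.perm k < π.perm i → π.perm j < π.perm i)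
    have := hne hij
    have := hne hjk
    have := hne (hij.trans hjk)
    omega
  · refine (hav _).trans (forall₅_congr fun i j k hij hjk => ?_)
    change (π.perm i < π.perm k → π.perm j ≤ π.perm k) ↔
      (π.perm i < π.perm j → π.perm i < π.perm k → π.perm j < π.perm k)
    have := hne hij
    have := hne hjk
    have := hne (hij.trans hjk)
    omega
  · refine (hav _).trans (forall₅_congr fun i j k hij hjk => ?_)
    change (π.perm j < π.perm i → π.perm k ≤ π.perm i) ↔
      (π.perm j < π.perm k → π.perm i < π.perm k → π.perm i < π.perm j)
    have := hne hij
    have := hne hjk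
    have := hne (hij.trans hjk)
    omega

theorem IsComb.slt_left {s t : Bool} {ρ x y : Permutation} {l r} (h : IsComb s ρ x y l r) (i j) :
    PermPattern.slt t (ρ.perm (l i)) (ρ.perm (l j)) ↔ PermPattern.slt t (x.perm i) (x.perm j) :=
  (slt_congr (h.left i j) (h.left j i)).symm

theorem IsComb.slt_right {s t : Bool} {ρ x y : Permutation} {l r} (h : IsComb s ρ x y l r) (i j) :
    PermPattern.slt t (ρ.perm (r i)) (ρ.perm (r j)) ↔ PermPattern.slt t (y.perm i) (y.perm j) :=
  (slt_congr (h.right i j) (h.right j i)).symm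

/-- A statement about pairs of elements of a sum or skew sum can be checked on the parts. -/
theorem IsComb.forall_pairs {s : Bool} {ρ x y : Permutation} {l r} (h : IsComb s ρ x y l r)
    {P : Fin ρ.size → Fin ρ.size → Prop} (hl : ∀ i j, i < j → P (l i) (l j))
    (hlr : ∀ i j, P (l i) (r j)) (hr : ∀ i j, i < j → P (r i) (r j)) (p q) (hpq : p < q) :
    P p q := by
  obtain ⟨i, rfl⟩ | ⟨i, rfl⟩ := h.cover p <;> obtain ⟨j, rfl⟩ | ⟨j, rfl⟩ := h.cover q
  · exact hl i j (l.lt_iff_lt.1 hpq)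
  · exact hlr i j
  · exact absurd hpq (lt_asymm (h.lt j i))
  · exact hr i j (r.lt_iff_lt.1 hpq)

/-- A statement about triples of elements of a sum or skew sum can be checked on the parts. -/
theorem IsComb.forall_triples {s : Bool} {ρ x y : Permutation} {l r} (h : IsComb s ρ x y l r)
    {P : Fin ρ.size → Fin ρ.size → Fin ρ.size → Prop}
    (hl : ∀ i j k, i < j → j < k → P (l i) (l j) (l k))
    (hllr : ∀ i j k, i < j → P (l i) (l j) (r k))
    (hlrr : ∀ i j k, j < k → P (l i) (r j) (r k))
    (hr : ∀ i j k, i < j → j < k → P (r i) (r j) (r k)) (p q t) (hpq : p < q) (hqt : q < t) :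
    P p q t := by
  revert hqt
  refine h.forall_pairs (P := fun p q => q < t → P p q t) ?_ ?_ ?_ p q hpq
  · intro i j hij hjt
    obtain ⟨k, rfl⟩ | ⟨k, rfl⟩ := h.cover t
    · exact hl i j k hij (l.lt_iff_lt.1 hjt)
    · exact hllr i j k hij
  · intro i j hjt
    obtain ⟨k, rfl⟩ | ⟨k, rfl⟩ := h.cover t
    · exact absurd hjt (lt_asymm (h.lt k j))
    · exact hlrr i j k (r.lt_iff_lt.1 hjt)
  · intro i j hij hjt
    obtain ⟨k, rfl⟩ | ⟨k, rfl⟩ := h.cover t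
    · exact absurd hjt (lt_asymm (h.lt k j))
    · exact hr i j k hij (r.lt_iff_lt.1 hjt)

theorem Shape.of_size_eq_zero (L : Letter) {π : Permutation} (h : π.size = 0) : Shape L π := by
  have : IsEmpty (Fin π.size) := by rw [h]; infer_instance
  unfold Shape
  split <;> exact isEmptyElim

theorem Shape.comb {L : Letter} (hL : L.br = false) {x y : Permutation} (hx : Shape L x)
    (hy : Shape L y) : Shape L (comb L.s x y) := by
  obtain ⟨s, left, br⟩ := L
  obtain rfl : br = false := hL
  obtain ⟨l, r, h⟩ := exists_isComb s x y
  exact h.forall_pairs (fun i j hij => (h.slt_left i j).2 (hx i j hij)) h.slt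
    fun i j hij => (h.slt_right i j).2 (hy i j hij)

theorem Shape.join {L : Letter} (hL : L.br = true) {x y : Permutation} (hx : Shape L x)
    (hy : Shape L y) : Shape L (PermPattern.comb (!L.s) x y) := by
  obtain ⟨s, left, br⟩ := L
  obtain rfl : br = true := hL
  obtain ⟨l, r, h⟩ := exists_isComb (!s) x y
  have hlr : ∀ i j, ¬ slt s ((PermPattern.comb (!s) x y).perm (l i))
    ((PermPattern.comb (!s) x y).perm (r j)) := fun i j => slt_asymm (slt_not.1 (h.slt i j))
  cases left
  · refine h.forall_triples ?_ (fun i j k _ _ hik => absurd hik (hlr i k))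
      (fun i j k _ hij => absurd hij (hlr i j)) ?_
    · intro i j k
      rw [h.slt_left, h.slt_left, h.slt_left]
      exact hx i j k
    · intro i j k
      rw [h.slt_right, h.slt_right, h.slt_right]
      exact hy i j k
  · refine h.forall_triples ?_ (fun i j k _ hjk => absurd hjk (hlr j k))
      (fun i j k _ _ hik => absurd hik (hlr i k)) ?_
    · intro i j k
      rw [h.slt_left, h.slt_left, h.slt_left]
      exact hx i j k
    · intro i j k
      rw [h.slt_right, h.slt_right, h.slt_right]
      exact hy i j k

theorem Shape.attach {L : Letter} {x : Permutation} (hx : Shape L x) :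
    Shape L (attach L x onePerm) := by
  have hone : ∀ i j : Fin onePerm.size, ¬ i < j := fun (i j : Fin 1) => by
    rw [Subsingleton.elim i j]
    exact lt_irrefl j
  obtain ⟨s, left, br⟩ := L
  cases br
  · have h1 : Shape ⟨s, left, false⟩ onePerm := fun i j hij => absurd hij (hone i j)
    cases left
    · exact hx.comb rfl h1
    · exact h1.comb rfl hx
  cases left
  · obtain ⟨l, r, h⟩ := exists_isComb s x onePerm
    refine h.forall_triples ?_ (fun i j k _ _ _ => h.slt j k)
      (fun i j k hjk => absurd hjk (hone j k)) fun i j k hij => absurd hij (hone i j)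
    intro i j k hij hjk h1 h2
    exact (h.slt_left j k).2
      (hx i j k hij hjk ((h.slt_left i j).1 h1) ((h.slt_left i k).1 h2))
  · obtain ⟨l, r, h⟩ := exists_isComb s onePerm x
    refine h.forall_triples (fun i j k hij => absurd hij (hone i j))
      (fun i j k hij => absurd hij (hone i j)) (fun i j k _ _ _ => h.slt i j) ?_
    intro i j k hij hjk h1 h2
    exact (h.slt_right i j).2
      (hx i j k hij hjk ((h.slt_right j k).1 h1) ((h.slt_right i k).1 h2))

/-- `π` is an inflation of `α` by members of `K`. -/
def InflatesTo (α : Permutation) (K : Set Permutation) (π : Permutation) : Prop :=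
  ∃ b : Fin π.size → Fin α.size, Monotone b ∧
    (∀ p q, b p ≠ b q → (π.perm p < π.perm q ↔ α.perm (b p) < α.perm (b q))) ∧
    ∀ m, ∃ τ ∈ K, HasPattern π (b ⁻¹' {m}) τ

theorem mem_inflation_iff {C K : Set Permutation} {π : Permutation} :
    π ∈ inflation C K ↔ ∃ α ∈ C, InflatesTo α K π := by
  constructor
  · rintro ⟨α, hα, τ, hτ, b, hb, hlt, hpat⟩
    exact ⟨α, hα, b, hb, hlt, fun m => ⟨τ m, hτ m, hpat m⟩⟩
  · rintro ⟨α, hα, b, hb, hlt, hpat⟩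
    choose τ hτ hpat using hpat
    exact ⟨α, hα, τ, hτ, b, hb, hlt, hpat⟩

theorem inflatesTo_onePerm {K : Set Permutation} {b : Permutation} (hb : b ∈ K) :
    InflatesTo onePerm K b := by
  refine ⟨fun _ => (0 : Fin 1), monotone_const, fun p q h => absurd rfl h, fun (m : Fin 1) =>
    ⟨b, hb, ?_⟩⟩
  convert hasPattern_univ b
  exact Set.eq_univ_of_forall fun _ => Subsingleton.elim (0 : Fin 1) m

theorem inflatesTo_emptyPerm (K : Set Permutation) : InflatesTo emptyPerm K emptyPerm :=
  ⟨id, monotone_id, fun _ _ _ => Iff.rfl, fun m : Fin 0 => m.elim0⟩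

theorem InflatesTo.comb {s : Bool} {α β x y : Permutation} {K : Set Permutation}
    (hx : InflatesTo α K x) (hy : InflatesTo β K y) :
    InflatesTo (comb s α β) K (PermPattern.comb s x y) := by
  obtain ⟨a, ha, halt, hapat⟩ := hx
  obtain ⟨b, hb, hblt, hbpat⟩ := hy
  obtain ⟨l, r, h⟩ := exists_isComb s x y
  obtain ⟨l', r', h'⟩ := exists_isComb s α β
  obtain ⟨c, hl, hr⟩ := h.exists_glue (l' ∘ a) (r' ∘ b)
  refine ⟨c, ?_, ?_, ?_⟩
  · intro p q hpq
    obtain rfl | hpq := hpq.eq_or_lt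
    · exact le_rfl
    revert p q
    suffices h0 : ∀ p q, p < q → c p ≤ c q from fun p q _ => h0 p q
    refine h.forall_pairs (fun i j hij => ?_) (fun i j => ?_) fun i j hij => ?_
    · rw [hl, hl]
      exact l'.monotone (ha hij.le)
    · rw [hl, hr]
      exact (h'.lt _ _).le
    · rw [hr, hr]
      exact r'.monotone (hb hij.le)
  · intro p q hpq
    obtain ⟨i, rfl⟩ | ⟨i, rfl⟩ := h.cover p <;> obtain ⟨j, rfl⟩ | ⟨j, rfl⟩ := h.cover q
    · rw [hl, hl] at hpq ⊢
      rw [← h.left, Function.comp, Function.comp, ← h'.left]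
      exact halt i j fun hij => hpq (congrArg l' hij)
    · rw [hl, hr]
      exact (slt_iff_slt (h.slt i j) (h'.slt (a i) (b j))).1
    · rw [hl, hr]
      exact (slt_iff_slt (h.slt j i) (h'.slt (a j) (b i))).2
    · rw [hr, hr] at hpq ⊢
      rw [← h.right, Function.comp, Function.comp, ← h'.right]
      exact hblt i j fun hij => hpq (congrArg r' hij)
  · intro m
    rw [h.preimage_eq, show c ∘ l = l' ∘ a from funext hl, show c ∘ r = r' ∘ b from funext hr]
    obtain ⟨i, rfl⟩ | ⟨j, rfl⟩ := h'.cover m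
    · obtain ⟨τ, hτ, hpat⟩ := hapat i
      refine ⟨τ, hτ, ?_⟩
      convert h.hasPattern_image_left hpat using 1
      have h1 : l' ∘ a ⁻¹' {l' i} = a ⁻¹' {i} := by
        ext
        simp
      have h2 : r' ∘ b ⁻¹' {l' i} = ∅ := by
        ext j
        simpa using (h'.lt i (b j)).ne'
      rw [h1, h2, Set.image_empty, Set.union_empty]
    · obtain ⟨τ, hτ, hpat⟩ := hbpat j
      refine ⟨τ, hτ, ?_⟩
      convert h.hasPattern_image_right hpat using 1
      have h1 : r' ∘ b ⁻¹' {r' j} = b ⁻¹' {j} := by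
        ext
        simp
      have h2 : l' ∘ a ⁻¹' {r' j} = ∅ := by
        ext i
        simpa using (h'.lt (a i) j).ne
      rw [h1, h2, Set.image_empty, Set.empty_union]

theorem Gen.mem_inflation {L : Letter} {K : Set Permutation} {π : Permutation} (h : Gen L K π) :
    π ∈ inflation (letterClass L) K := by
  simp only [mem_inflation_iff, mem_letterClass_iff]
  induction h with
  | empty => exact ⟨emptyPerm, Shape.of_size_eq_zero L rfl, inflatesTo_emptyPerm K⟩
  | @attach x b _ hb ih =>
    obtain ⟨α, hα, hx⟩ := ih
    refine ⟨PermPattern.attach L α onePerm, hα.attach, ?_⟩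
    unfold PermPattern.attach
    cases L.left
    · exact hx.comb (inflatesTo_onePerm hb)
    · exact (inflatesTo_onePerm hb).comb hx
  | join hbr _ _ ih₁ ih₂ =>
    obtain ⟨α, hα, hx⟩ := ih₁
    obtain ⟨β, hβ, hy⟩ := ih₂
    exact ⟨_, hα.join hbr hβ, hx.comb hy⟩

theorem exists_slt_max (s : Bool) {n : ℕ} {ι : Type*} {T : Finset ι} (hT : T.Nonempty)
    {v : ι → Fin n} (hv : Function.Injective v) :
    ∃ p ∈ T, ∀ q ∈ T, q ≠ p → slt s (v q) (v p) := by
  cases s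
  · obtain ⟨p, hp, h⟩ := T.exists_min_image v hT
    exact ⟨p, hp, fun q hq hqp => (h q hq).lt_of_ne (hv.ne hqp).symm⟩
  · obtain ⟨p, hp, h⟩ := T.exists_max_image v hT
    exact ⟨p, hp, fun q hq hqp => (h q hq).lt_of_ne (hv.ne hqp)⟩

/-- A set of elements of a member of `letterClass L` is built from the empty set by attaching
elements and joining, hence the corresponding union of blocks of an inflation is built by attaching
blocks and joining. The element attached last is the one that is extreme in value. -/
theorem gen_of_blocks {L : Letter} {K : Set Permutation} {π α : Permutation} (hα : Shape L α)
    {b : Fin π.size → Fin α.size} (hb : Monotone b)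
    (hlt : ∀ p q, b p ≠ b q → (π.perm p < π.perm q ↔ α.perm (b p) < α.perm (b q)))
    (hpat : ∀ m, ∃ τ ∈ K, HasPattern π (b ⁻¹' {m}) τ) (T : Finset (Fin α.size)) :
    ∃ ρ, Gen L K ρ ∧ HasPattern π (b ⁻¹' T) ρ := by
  have hunion : ∀ {s : Bool} {U V : Set (Fin α.size)} {σ τ : Permutation},
      HasPattern π (b ⁻¹' U) σ → HasPattern π (b ⁻¹' V) τ →
      (∀ u ∈ U, ∀ v ∈ V, u < v ∧ slt s (α.perm u) (α.perm v)) →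
      HasPattern π (b ⁻¹' (U ∪ V)) (comb s σ τ) := by
    intro s U V σ τ hU hV h
    refine hU.union hV fun p hp q hq => ?_
    obtain ⟨h1, h2⟩ := h _ hp _ hq
    exact ⟨lt_of_not_ge fun hqp => (hb hqp).not_gt h1,
      (slt_congr (hlt p q h1.ne) (hlt q p h1.ne')).2 h2⟩
  induction T using Finset.strongInduction with | _ T ih
  rcases T.eq_empty_or_nonempty with rfl | hT
  · exact ⟨emptyPerm, .empty, by simpa using hasPattern_empty π⟩
  have hsub : ∀ {p} (_ : p ∈ T) (Q : Fin α.size → Prop) [DecidablePred Q], ¬ Q p →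
      T.filter Q ⊂ T := fun {p} hp Q _ hQ => Finset.filter_ssubset.2 ⟨p, hp, hQ⟩
  have hcover : ∀ {p} (_ : p ∈ T), ((T.filter (· < p) : Finset _) : Set (Fin α.size)) ∪ {p} ∪
      (T.filter (p < ·) : Finset _) = T := by
    intro p hp
    ext q
    simp only [Finset.coe_filter, Set.mem_union, Set.mem_ofPred_eq, Set.mem_singleton_iff,
      Finset.mem_coe]
    rcases lt_trichotomy q p with h | rfl | h
    · simp [h, h.ne, h.not_gt]
    · simp [hp]
    · simp [h, h.ne', h.not_gt]
  obtain ⟨s, left, br⟩ := L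
  cases br <;> cases left
  · obtain ⟨p, hp, hmax⟩ := T.exists_max_image id hT
    obtain ⟨ρ, hρ, hρp⟩ := ih _ (hsub hp (· < p) (lt_irrefl p))
    obtain ⟨τ, hτ, hτp⟩ := hpat p
    have h := hunion (s := s) hρp hτp ?_
    · rw [← hcover hp, Finset.filter_false_of_mem (p := (p < ·)), Finset.coe_empty, Set.union_empty]
      · exact ⟨_, hρ.attach hτ, h⟩
      · exact fun q hq => (hmax q hq).not_gt
    · rintro u hu _ rfl
      have hu := (Finset.mem_filter.1 hu).2
      exact ⟨hu, hα _ _ hu⟩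
  · obtain ⟨p, hp, hmin⟩ := T.exists_min_image id hT
    obtain ⟨ρ, hρ, hρp⟩ := ih _ (hsub hp (p < ·) (lt_irrefl p))
    obtain ⟨τ, hτ, hτp⟩ := hpat p
    have h := hunion (s := s) hτp hρp ?_
    · rw [← hcover hp, Finset.filter_false_of_mem (p := (· < p)), Finset.coe_empty, Set.empty_union]
      · exact ⟨_, hρ.attach hτ, h⟩
      · exact fun q hq => (hmin q hq).not_gt
    · rintro _ rfl u hu
      have hu := (Finset.mem_filter.1 hu).2
      exact ⟨hu, hα _ _ hu⟩
  · obtain ⟨p, hp, hmax⟩ := exists_slt_max s hT α.perm.injective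
    obtain ⟨ρ, hρ, hρp⟩ := ih _ (hsub hp (· < p) (lt_irrefl p))
    obtain ⟨ρ', hρ', hρp'⟩ := ih _ (hsub hp (p < ·) (lt_irrefl p))
    obtain ⟨τ, hτ, hτp⟩ := hpat p
    have h₁ := hunion (s := s) hρp hτp ?_
    · have h₂ := hunion (s := !s) h₁ hρp' ?_
      · rw [← hcover hp]
        exact ⟨_, .join rfl (hρ.attach hτ) hρ', h₂⟩
      · rintro u hu v hv
        obtain ⟨hv, hpv⟩ := Finset.mem_filter.1 hv
        have hvp := hmax v hv hpv.ne'
        rcases hu with hu | rfl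
        · obtain ⟨hu, hup⟩ := Finset.mem_filter.1 hu
          refine ⟨hup.trans hpv, slt_not.2 ?_⟩
          refine (slt_trichotomy s
            (α.perm.injective.ne (hup.trans hpv).ne)).resolve_left fun huv => ?_
          exact slt_asymm hvp (hα u p v hup hpv (hmax u hu hup.ne) huv)
        · exact ⟨hpv, slt_not.2 hvp⟩
    · rintro u hu _ rfl
      obtain ⟨hu, hlt⟩ := Finset.mem_filter.1 hu
      exact ⟨hlt, hmax u hu hlt.ne⟩
  · obtain ⟨p, hp, hmin⟩ := exists_slt_max (!s) hT α.perm.injective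
    simp only [slt_not] at hmin
    obtain ⟨ρ, hρ, hρp⟩ := ih _ (hsub hp (· < p) (lt_irrefl p))
    obtain ⟨ρ', hρ', hρp'⟩ := ih _ (hsub hp (p < ·) (lt_irrefl p))
    obtain ⟨τ, hτ, hτp⟩ := hpat p
    have h₁ := hunion (s := s) hτp hρp' ?_
    · have h₂ := hunion (s := !s) hρp h₁ ?_
      · rw [← hcover hp, Set.union_assoc]
        exact ⟨_, .join rfl hρ (hρ'.attach hτ), h₂⟩
      · rintro u hu v hv
        obtain ⟨hu, hup⟩ := Finset.mem_filter.1 hu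
        have hpu := hmin u hu hup.ne
        rcases hv with rfl | hv
        · exact ⟨hup, slt_not.2 hpu⟩
        · obtain ⟨hv, hpv⟩ := Finset.mem_filter.1 hv
          refine ⟨hup.trans hpv, slt_not.2 ?_⟩
          refine (slt_trichotomy s
            (α.perm.injective.ne (hup.trans hpv).ne)).resolve_left fun huv => ?_
          exact slt_asymm hpu (hα u p v hup hpv (hmin v hv hpv.ne') huv)
    · rintro _ rfl u hu
      obtain ⟨hu, hlt⟩ := Finset.mem_filter.1 hu
      exact ⟨hlt, hmin u hu hlt.ne'⟩

theorem inflation_letterClass (L : Letter) (K : Set Permutation) :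
    inflation (letterClass L) K = {π | Gen L K π} := by
  ext π
  refine ⟨fun h => ?_, Gen.mem_inflation⟩
  obtain ⟨α, hα, b, hb, hlt, hpat⟩ := mem_inflation_iff.1 h
  obtain ⟨ρ, hρ, hρp⟩ := gen_of_blocks ((mem_letterClass_iff L α).1 hα) hb hlt hpat Finset.univ
  rw [Finset.coe_univ, Set.preimage_univ] at hρp
  rwa [Set.mem_ofPred_eq, (hasPattern_univ π).unique hρp]

theorem Gen.comb {L : Letter} (hL : L.br = false) {K : Set Permutation} {x y : Permutation}
    (hx : Gen L K x) (hy : Gen L K y) : Gen L K (comb L.s x y) := by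
  have hx := hx.mem_inflation
  have hy := hy.mem_inflation
  rw [mem_inflation_iff] at hx hy
  obtain ⟨α, hα, hx⟩ := hx
  obtain ⟨β, hβ, hy⟩ := hy
  change PermPattern.comb L.s x y ∈ {π | Gen L K π}
  rw [← inflation_letterClass, mem_inflation_iff]
  rw [mem_letterClass_iff] at hα hβ
  exact ⟨_, (mem_letterClass_iff L _).2 (hα.comb hL hβ), hx.comb hy⟩


/-! ### Representable classes -/

/-- The representable class given by a word of letters, described by its members' construction. -/
def wordClass : List Letter → Set Permutation
  | [] => unitClass
  | L :: w => {π | Gen L (wordClass w) π}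

theorem range_letterClass : Set.range letterClass = alphabet := by
  ext C
  simp only [alphabet, Set.mem_insert_iff, Set.mem_singleton_iff]
  constructor
  · rintro ⟨⟨s, left, br⟩, rfl⟩
    cases s <;> cases left <;> cases br <;> simp [letterClass]
  · rintro (rfl | rfl | rfl | rfl | rfl | rfl)
    · exact ⟨⟨true, false, false⟩, rfl⟩
    · exact ⟨⟨false, false, false⟩, rfl⟩
    · exact ⟨⟨true, false, true⟩, rfl⟩
    · exact ⟨⟨true, true, true⟩, rfl⟩
    · exact ⟨⟨false, true, true⟩, rfl⟩
    · exact ⟨⟨false, false, true⟩, rfl⟩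

theorem classOfWord_map (w : List Letter) : classOfWord (w.map letterClass) = wordClass w := by
  induction w with
  | nil => rfl
  | cons L w ih =>
    rw [List.map_cons, wordClass, ← ih, ← inflation_letterClass]
    rfl

theorem representable_iff {C : Set Permutation} : Representable C ↔ ∃ w, C = wordClass w := by
  have h : ∀ w : List (Set Permutation), (∀ L ∈ w, L ∈ alphabet) ↔
      ∃ v : List Letter, v.map letterClass = w := by
    intro w
    rw [← range_letterClass]
    exact (Set.ext_iff.1 (Set.range_list_map letterClass) w).symm
  simp only [Representable, h]
  constructor
  · rintro ⟨_, ⟨v, rfl⟩, rfl⟩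
    exact ⟨v, classOfWord_map v⟩
  · rintro ⟨v, rfl⟩
    exact ⟨_, ⟨v, rfl⟩, (classOfWord_map v).symm⟩

theorem emptyPerm_mem_wordClass : ∀ w, emptyPerm ∈ wordClass w
  | [] => Nat.zero_le 1
  | _ :: _ => Gen.empty

theorem onePerm_mem_wordClass : ∀ w, onePerm ∈ wordClass w
  | [] => le_refl 1
  | _ :: w => Gen.of_mem (onePerm_mem_wordClass w)

theorem isLowerSet_wordClass (w : List Letter) : IsLowerSet (wordClass w) := by
  induction w with
  | nil => exact fun π σ h hπ => (size_le_of_le h).trans hπ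
  | cons L w ih =>
    intro π σ h (hπ : Gen L _ π)
    induction hπ generalizing σ with
    | empty =>
      rw [eq_emptyPerm_of_size (Nat.le_zero.1 (size_le_of_le h))]
      exact Gen.empty
    | @attach x b _ hb ihx =>
      obtain ⟨s, left, br⟩ := L
      cases left
      · obtain ⟨x', b', hx, hb', rfl⟩ := exists_of_le_comb (s := s) h
        exact Gen.attach (ihx hx) (ih hb' hb)
      · obtain ⟨b', x', hb', hx, rfl⟩ := exists_of_le_comb (s := s) h
        exact Gen.attach (ihx hx) (ih hb' hb)
    | join hbr _ _ ihx ihy =>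
      obtain ⟨x', y', hx, hy, rfl⟩ := exists_of_le_comb h
      exact Gen.join hbr (ihx hx) (ihy hy)

theorem wordClass_mono {v w : List Letter} (h : v.Sublist w) : wordClass v ⊆ wordClass w := by
  induction h with
  | slnil => exact le_rfl
  | cons L _ ih => exact fun π hπ => Gen.of_mem (ih hπ)
  | cons_cons L _ ih => exact fun π hπ => Gen.mono ih hπ

/-- Representable classes are well-quasi-ordered by inclusion, by Higman's lemma. -/
theorem wellQuasiOrdered_wordClass :
    WellQuasiOrdered fun v w : List Letter => wordClass v ⊆ wordClass w := by
  have h := Set.PartiallyWellOrderedOn.partiallyWellOrderedOn_sublistForall₂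
    (r := ((· = ·) : Letter → Letter → Prop)) (s := Set.univ)
    (Set.finite_univ.partiallyWellOrderedOn)
  intro f
  obtain ⟨m, n, hmn, hsub⟩ := h fun n => ⟨f n, fun L _ => Set.mem_univ L⟩
  refine ⟨m, n, hmn, wordClass_mono ?_⟩
  obtain ⟨l, hl, hl'⟩ := List.sublistForall₂_iff.1 hsub
  rw [List.forall₂_eq_eq_eq] at hl
  obtain rfl : f m = l := hl
  exact hl'

/-! ### Representable classes are not merges of smaller classes -/

/-- Whenever the elements of `ρ` are coloured red (`true`) and blue (`false`), there is a red copy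
of `σ` or a blue copy of `τ`. -/
def Arrows (ρ σ τ : Permutation) : Prop :=
  ∀ f : Bool → Permutation, Coloured ρ f → σ ≤ f true ∨ τ ≤ f false

theorem Arrows.comb_left {s : Bool} {ρ₁ ρ₂ σ₁ σ₂ τ : Permutation} (h₁ : Arrows ρ₁ σ₁ τ)
    (h₂ : Arrows ρ₂ σ₂ τ) : Arrows (comb s ρ₁ ρ₂) (comb s σ₁ σ₂) τ := by
  intro f hf
  obtain ⟨f₁, f₂, hf₁, hf₂, h⟩ := hf.exists_of_comb
  rw [h, h]
  rcases h₁ f₁ hf₁ with h₁ | h₁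
  · rcases h₂ f₂ hf₂ with h₂ | h₂
    · exact Or.inl (comb_mono s h₁ h₂)
    · exact Or.inr (h₂.trans (le_comb_right _ _ _))
  · exact Or.inr (h₁.trans (le_comb_left _ _ _))

theorem Arrows.symm {ρ σ τ : Permutation} (h : Arrows ρ σ τ) : Arrows ρ τ σ := by
  rintro f ⟨c, hc⟩
  refine (h (fun i => f !i) ⟨fun p => !(c p), fun i => ?_⟩).symm
  convert hc (!i) using 1
  ext p
  simp [Bool.not_eq_eq_eq_not]

theorem Arrows.attach {L : Letter} {s : Bool} {ρ₁ ρ₂ ρ₃ σ τ a b : Permutation}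
    (h₁ : Arrows ρ₁ σ (attach L τ b)) (h₂ : Arrows ρ₂ (attach L σ a) τ) (h₃ : Arrows ρ₃ a b) :
    Arrows (PermPattern.attach L (comb s ρ₁ ρ₂) ρ₃) (PermPattern.attach L σ a)
      (PermPattern.attach L τ b) := by
  intro f hf
  obtain ⟨g, f₃, hg, hf₃, h⟩ := hf.exists_of_attach
  obtain ⟨f₁, f₂, hf₁, hf₂, h'⟩ := hg.exists_of_comb
  have hle₁ : ∀ i, f₁ i ≤ g i := fun i => (h' i).symm ▸ le_comb_left _ _ _
  have hle₂ : ∀ i, f₂ i ≤ g i := fun i => (h' i).symm ▸ le_comb_right _ _ _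
  rw [h, h]
  rcases h₃ f₃ hf₃ with h₃ | h₃
  · rcases h₁ f₁ hf₁ with h₁ | h₁
    · exact Or.inl (attach_mono L (h₁.trans (hle₁ _)) h₃)
    · exact Or.inr ((h₁.trans (hle₁ _)).trans (le_attach_left _ _ _))
  · rcases h₂ f₂ hf₂ with h₂ | h₂
    · exact Or.inl ((h₂.trans (hle₂ _)).trans (le_attach_left _ _ _))
    · exact Or.inr (attach_mono L (h₂.trans (hle₂ _)) h₃)

theorem Gen.exists_comb_closed (L : Letter) (K : Set Permutation) :
    ∃ s, ∀ {x y}, Gen L K x → Gen L K y → Gen L K (PermPattern.comb s x y) := by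
  cases hbr : L.br
  · exact ⟨L.s, fun hx hy => hx.comb hbr hy⟩
  · exact ⟨!L.s, fun hx hy => hx.join hbr hy⟩

/-- The Ramsey property passes from `K` to the permutations built from `K` by a letter. In the main
case, that of `attach L x a` and `attach L y b`, a red copy of `a` in the attached part is completed
by a red copy of `x` in the rest, and a blue copy of `b` by a blue copy of `y`. -/
theorem Gen.exists_arrows {L : Letter} {K : Set Permutation}
    (hK : ∀ a ∈ K, ∀ b ∈ K, ∃ ρ ∈ K, Arrows ρ a b) {σ τ : Permutation} (hσ : Gen L K σ)
    (hτ : Gen L K τ) : ∃ ρ, Gen L K ρ ∧ Arrows ρ σ τ := by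
  obtain ⟨s, hs⟩ := Gen.exists_comb_closed L K
  induction hσ generalizing τ with
  | empty => exact ⟨_, .empty, fun f _ => Or.inl (emptyPerm_le _)⟩
  | join hbr _ _ ih₁ ih₂ =>
    obtain ⟨ρ₁, hρ₁, h₁⟩ := ih₁ hτ
    obtain ⟨ρ₂, hρ₂, h₂⟩ := ih₂ hτ
    exact ⟨_, .join hbr hρ₁ hρ₂, h₁.comb_left h₂⟩
  | attach _ ha ih =>
    induction hτ with
    | empty => exact ⟨_, .empty, fun f _ => Or.inr (emptyPerm_le _)⟩
    | join hbr _ _ ih₁ ih₂ =>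
      obtain ⟨ρ₁, hρ₁, h₁⟩ := ih₁
      obtain ⟨ρ₂, hρ₂, h₂⟩ := ih₂
      exact ⟨_, .join hbr hρ₁ hρ₂, (h₁.symm.comb_left h₂.symm).symm⟩
    | attach hτ hb ih' =>
      obtain ⟨ρ₁, hρ₁, h₁⟩ := ih (hτ.attach hb)
      obtain ⟨ρ₂, hρ₂, h₂⟩ := ih'
      obtain ⟨ρ₃, hρ₃, h₃⟩ := hK _ ha _ hb
      exact ⟨_, .attach (hs hρ₁ hρ₂) hρ₃, h₁.attach h₂ h₃⟩

theorem exists_arrows (w : List Letter) :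
    ∀ σ ∈ wordClass w, ∀ τ ∈ wordClass w, ∃ ρ ∈ wordClass w, Arrows ρ σ τ := by
  induction w with
  | nil =>
    intro σ hσ τ hτ
    refine ⟨onePerm, le_refl 1, ?_⟩
    rintro f ⟨c, hc⟩
    have hpos : 0 < (f (c (0 : Fin 1))).size := by
      obtain ⟨e, he, -⟩ := hc (c (0 : Fin 1))
      have : (0 : Fin 1) ∈ Set.range e := by
        rw [he]
        rfl
      obtain ⟨i, -⟩ := this
      exact i.pos
    have h1 := onePerm_le hpos
    cases hc0 : c (0 : Fin 1)
    · rw [hc0] at h1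
      exact Or.inr ((le_onePerm hτ).trans h1)
    · rw [hc0] at h1
      exact Or.inl ((le_onePerm hσ).trans h1)
  | cons L w ih => exact fun σ hσ τ hτ => Gen.exists_arrows ih hσ hτ

/-- The Ramsey property for any number of colours. -/
theorem exists_forall_coloured_le (w : List Letter) {k : ℕ} (σ : Fin k → Permutation)
    (hσ : ∀ i, σ i ∈ wordClass w) :
    ∃ ρ ∈ wordClass w, ∀ f, Coloured ρ f → ∃ i, σ i ≤ f i := by
  induction k with
  | zero =>
    refine ⟨onePerm, onePerm_mem_wordClass w, ?_⟩
    rintro f ⟨c, -⟩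
    exact (c (0 : Fin 1)).elim0
  | succ k ih =>
    obtain ⟨ρ', hρ', h'⟩ := ih (fun i => σ i.succ) fun i => hσ i.succ
    obtain ⟨ρ, hρ, h⟩ := exists_arrows w _ (hσ 0) _ hρ'
    refine ⟨ρ, hρ, fun f hf => ?_⟩
    obtain ⟨g, hg, hgf⟩ := hf.exists_cons
    rcases h _ hg with h0 | h0
    · exact ⟨0, h0⟩
    · obtain ⟨f', hf', hle⟩ := hgf.exists_of_le h0
      obtain ⟨i, hi⟩ := h' f' hf'
      exact ⟨i.succ, hi.trans (hle i)⟩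

theorem exists_subset_of_subset_merge {w : List Letter} {k : ℕ} {C : Fin k → Set Permutation}
    (hC : ∀ i, IsLowerSet (C i)) (h : wordClass w ⊆ merge C) : ∃ i, wordClass w ⊆ C i := by
  by_contra! hcon
  choose σ hσ hσC using fun i => Set.not_subset.1 (hcon i)
  obtain ⟨ρ, hρ, hf⟩ := exists_forall_coloured_le w σ hσ
  obtain ⟨f, hc, hfC⟩ := mem_merge_iff.1 (h hρ)
  obtain ⟨i, hi⟩ := hf f hc
  exact hσC i (hC i hi (hfC i))


/-! ### Splitting the separable permutations that avoid a given one -/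

/-- The elements of `π` can be coloured so that those of colour `i` have a pattern in the class of
the word `w i`. -/
def Splits {ι : Type*} (w : ι → List Letter) (π : Permutation) : Prop :=
  ∃ f, Coloured π f ∧ ∀ i, f i ∈ wordClass (w i)

theorem IsSeparable.comb (s : Bool) {x y : Permutation} (hx : IsSeparable x) (hy : IsSeparable y) :
    IsSeparable (PermPattern.comb s x y) := by
  cases s
  · exact hx.skewSum hy
  · exact hx.sum hy

/-- Induction on separable permutations that treats sums and skew sums alike. -/
theorem IsSeparable.comb_induction {P : ∀ π, IsSeparable π → Prop} (empty : P emptyPerm .empty)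
    (one : P onePerm .one)
    (comb : ∀ s x y (hx : IsSeparable x) (hy : IsSeparable y), P x hx → P y hy →
      P (PermPattern.comb s x y) (hx.comb s hy))
    {π : Permutation} (h : IsSeparable π) : P π h := by
  induction h with
  | empty => exact empty
  | one => exact one
  | sum hx hy ihx ihy => exact comb true _ _ hx hy ihx ihy
  | skewSum hx hy ihx ihy => exact comb false _ _ hx hy ihx ihy

theorem not_le_or_not_le_of_comb {s : Bool} {γ δ x y : Permutation}
    (h : ¬ comb s γ δ ≤ comb s x y) : ¬ γ ≤ x ∨ ¬ δ ≤ y := by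
  by_contra! hcon
  exact h (comb_mono s hcon.1 hcon.2)

/-- The separable permutations that avoid `σ` split into finitely many representable classes.
Permutations of size at most one are included for the sake of the induction, as a single element may
contain both `γ` and `δ` without containing `comb s γ δ`.

If `π` avoids `comb s γ δ`, then at each node `comb s x y` of its decomposition, `x` avoids `γ` or
`y` avoids `δ`. The parts of the first kind, which are attached on the left, form together an
inflation by permutations avoiding `γ`, those of the second kind an inflation by permutations
avoiding `δ`. -/
theorem IsSeparable.exists_splits {σ : Permutation} (hσ : IsSeparable σ) :
    ∃ (ι : Type) (_ : Finite ι) (w : ι → List Letter), ∀ π, IsSeparable π →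
      ¬ σ ≤ π ∨ π.size ≤ 1 → Splits w π := by
  induction hσ using IsSeparable.comb_induction with
  | empty =>
    refine ⟨Unit, inferInstance, fun _ => [], fun π _ h => ⟨_, Coloured.unit π, fun _ => ?_⟩⟩
    exact h.resolve_left (not_not_intro (emptyPerm_le π))
  | one =>
    refine ⟨Unit, inferInstance, fun _ => [], fun π _ h => ⟨_, Coloured.unit π, fun _ => ?_⟩⟩
    rcases h with h | h
    · exact not_lt.1 fun h1 => h (onePerm_le (Nat.one_pos.trans h1))
    · exact h
  | comb s γ δ _ _ ihγ ihδ =>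
    obtain ⟨ι, hι, v, hv⟩ := ihγ
    obtain ⟨κ, hκ, w, hw⟩ := ihδ
    refine ⟨ι ⊕ κ, inferInstance, Sum.elim (fun i => ⟨s, true, true⟩ :: v i)
      fun i => ⟨s, false, true⟩ :: w i, fun π hπ => ?_⟩
    have hleft : ∀ {π}, Splits v π → Splits (Sum.elim (fun i => ⟨s, true, true⟩ :: v i)
        fun i => ⟨s, false, true⟩ :: w i) π := by
      rintro π ⟨f, hf, hfv⟩
      refine ⟨_, hf.inl, ?_⟩
      rintro (i | i)
      · exact Gen.of_mem (hfv i)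
      · exact Gen.empty
    induction hπ using IsSeparable.comb_induction with
    | empty => exact fun _ => hleft (hv _ .empty (Or.inr (Nat.zero_le 1)))
    | one => exact fun _ => hleft (hv _ .one (Or.inr le_rfl))
    | comb t x y hx hy ihx ihy =>
      intro h
      rcases h.symm with h | h
      · exact hleft (hv _ (hx.comb t hy) (Or.inr h))
      have ihx := ihx (Or.inl fun hc => h (hc.trans (le_comb_left t x y)))
      have ihy := ihy (Or.inl fun hc => h (hc.trans (le_comb_right t x y)))
      obtain rfl | rfl : t = s ∨ t = !s := by
        cases s <;> cases t <;> simp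
      · -- The part avoiding `γ` or `δ` is split by the induction hypothesis for `γ` or `δ`, and its
        -- colour classes are attached, on the left or right, to those of the other part.
        rcases not_le_or_not_le_of_comb h with hγ | hδ
        · obtain ⟨f, hf, hfv⟩ := hv x hx (Or.inl hγ)
          obtain ⟨g, hg, hgw⟩ := ihy
          refine ⟨_, hf.inl.comb hg, ?_⟩
          rintro (i | i)
          · exact Gen.attach (hgw (Sum.inl i)) (hfv i)
          · change PermPattern.comb t emptyPerm (g (Sum.inr i)) ∈ _
            rw [comb_empty_left]
            exact hgw (Sum.inr i)
        · obtain ⟨f, hf, hfw⟩ := hw y hy (Or.inl hδ)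
          obtain ⟨g, hg, hgv⟩ := ihx
          refine ⟨_, hg.comb hf.inr, ?_⟩
          rintro (i | i)
          · change PermPattern.comb t (g (Sum.inl i)) emptyPerm ∈ _
            rw [comb_empty_right]
            exact hgv (Sum.inl i)
          · exact Gen.attach (hgv (Sum.inr i)) (hfw i)
      · obtain ⟨f, hf, hf'⟩ := ihx
        obtain ⟨g, hg, hg'⟩ := ihy
        refine ⟨_, hf.comb hg, ?_⟩
        rintro (i | i)
        · exact Gen.join rfl (hf' (Sum.inl i)) (hg' (Sum.inl i))
        · exact Gen.join rfl (hf' (Sum.inr i)) (hg' (Sum.inr i))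

/-! ### Splitting the members of a representable class that avoid a given one -/

/-- The complexity of a word. A branching letter weighs more than the two non-branching letters by
which it is replaced when a class is split. -/
def weight : List Letter → ℕ
  | [] => 0
  | L :: w => (bif L.br then 3 else 1) + weight w

/-- Splitting for a non-branching letter `L`. In an inflation avoiding `attach L σ b`, the blocks
avoiding `b` are split; a block containing `b` is kept whole, and what it is attached to avoids
`σ`. -/
theorem Gen.exists_splits_of_br_eq_false {L : Letter} (hL : L.br = false) {w : List Letter}
    (hw : ∀ b ∈ wordClass w, ∃ (ι : Type) (_ : Finite ι) (v : ι → List Letter),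
      (∀ i, weight (v i) < weight w) ∧ ∀ π ∈ wordClass w, ¬ b ≤ π → Splits v π)
    {σ : Permutation} (hσ : Gen L (wordClass w) σ) :
    ∃ (ι : Type) (_ : Finite ι) (v : ι → List Letter), (∀ i, weight (v i) < 1 + weight w) ∧
      ∀ π, Gen L (wordClass w) π → ¬ σ ≤ π → Splits v π := by
  induction hσ with
  | empty => exact ⟨Empty, inferInstance, Empty.elim, fun i => i.elim,
      fun π _ h => absurd (emptyPerm_le π) h⟩
  | join hbr => exact absurd (hL.symm.trans hbr) (by decide)
  | @attach σ b _ hb ih =>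
    obtain ⟨ι, hι, u, hu, hπu⟩ := ih
    obtain ⟨κ, hκ, v, hv, hπv⟩ := hw b hb
    refine ⟨ι ⊕ (κ ⊕ Unit), inferInstance,
      Sum.elim u (Sum.elim (fun i => L :: v i) fun _ => w), ?_, fun π hπ => ?_⟩
    · rintro (i | i | i)
      · exact hu i
      · simpa [weight, hL] using hv i
      · exact Nat.lt_add_of_pos_left Nat.one_pos
    · induction hπ with
      | empty =>
        refine fun _ => ⟨_, Coloured.empty, ?_⟩
        rintro (i | i | i) <;> exact emptyPerm_mem_wordClass _
      | join hbr => exact absurd (hL.symm.trans hbr) (by decide)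
      | @attach x c hx hc ihx =>
        intro h
        by_cases hbc : b ≤ c
        · obtain ⟨f, hf, hfu⟩ := hπu x hx fun hσx => h (attach_mono L hσx hbc)
          refine ⟨_, hf.inl.attach (Coloured.unit c).inr.inr, ?_⟩
          rintro (i | i | i)
          · exact (attach_empty_right L (f i)).symm ▸ hfu i
          · exact (attach_empty_right L emptyPerm).symm ▸ emptyPerm_mem_wordClass _
          · exact (attach_empty_left L c).symm ▸ hc
        · obtain ⟨f, hf, hfu⟩ := ihx fun hσx => h (hσx.trans (le_attach_left L x c))
          obtain ⟨g, hg, hgv⟩ := hπv c hc hbc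
          refine ⟨_, hf.attach hg.inl.inr, ?_⟩
          rintro (i | i | i)
          · exact (attach_empty_right L _).symm ▸ hfu (Sum.inl i)
          · exact Gen.attach (hfu (Sum.inr (Sum.inl i))) (hgv i)
          · exact (attach_empty_right L _).symm ▸ hfu (Sum.inr (Sum.inr i))

/-- Splitting for a branching letter `L`. All classes used are closed under the operation that `L`
joins by, so only the attaching steps matter. If `σ = attach L σ' b`, then the blocks avoiding `b`
are split; those that contain `b` form one more colour, and what they are attached to avoids `σ'`.
If `σ` is the join of `σ₁` and `σ₂`, then in a join one part avoids `σ₁` or `σ₂`, hence splits, so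
that what remains is built by attaching only. -/
theorem Gen.exists_splits_of_br_eq_true {L : Letter} (hL : L.br = true) {w : List Letter}
    (hw : ∀ b ∈ wordClass w, ∃ (ι : Type) (_ : Finite ι) (v : ι → List Letter),
      (∀ i, weight (v i) < weight w) ∧ ∀ π ∈ wordClass w, ¬ b ≤ π → Splits v π)
    {σ : Permutation} (hσ : Gen L (wordClass w) σ) :
    ∃ (ι : Type) (_ : Finite ι) (v : ι → List Letter), (∀ i, weight (v i) < 3 + weight w) ∧
      (∀ i, ∀ x ∈ wordClass (v i), ∀ y ∈ wordClass (v i),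
        PermPattern.comb (!L.s) x y ∈ wordClass (v i)) ∧
      ∀ π, Gen L (wordClass w) π → ¬ σ ≤ π → Splits v π := by
  have hclosed : ∀ u, ∀ x ∈ wordClass (⟨!L.s, false, false⟩ :: u),
      ∀ y ∈ wordClass (⟨!L.s, false, false⟩ :: u),
      PermPattern.comb (!L.s) x y ∈ wordClass (⟨!L.s, false, false⟩ :: u) :=
    fun u x hx y hy => Gen.comb (L := ⟨!L.s, false, false⟩) rfl hx hy
  induction hσ with
  | empty => exact ⟨Empty, inferInstance, Empty.elim, fun i => i.elim, fun i => i.elim,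
      fun π _ h => absurd (emptyPerm_le π) h⟩
  | @attach σ b _ hb ih =>
    obtain ⟨ι, hι, u, hu, hu', hπu⟩ := ih
    obtain ⟨κ, hκ, v, hv, hπv⟩ := hw b hb
    have hcl : ∀ i x, x ∈ wordClass (Sum.elim u (Sum.elim (fun i => L :: v i)
          fun _ : Unit => ⟨!L.s, false, false⟩ :: w) i) →
        ∀ y ∈ wordClass (Sum.elim u (Sum.elim (fun i => L :: v i)
          fun _ : Unit => ⟨!L.s, false, false⟩ :: w) i),
        PermPattern.comb (!L.s) x y ∈ wordClass (Sum.elim u (Sum.elim (fun i => L :: v i)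
          fun _ : Unit => ⟨!L.s, false, false⟩ :: w) i) := by
      rintro (i | i | i)
      · exact hu' i
      · exact fun x hx y hy => Gen.join hL hx hy
      · exact hclosed w
    refine ⟨ι ⊕ (κ ⊕ Unit), inferInstance, Sum.elim u (Sum.elim (fun i => L :: v i)
      fun _ => ⟨!L.s, false, false⟩ :: w), ?_, hcl, fun π hπ => ?_⟩
    · rintro (i | i | i)
      · exact hu i
      · simpa [weight, hL] using hv i
      · simp [weight]
    · induction hπ with
      | empty =>
        refine fun _ => ⟨_, Coloured.empty, ?_⟩
        rintro (i | i | i) <;> exact emptyPerm_mem_wordClass _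
      | @join x y _ _ _ ihx ihy =>
        intro h
        obtain ⟨f, hf, hf'⟩ := ihx fun hc => h (hc.trans (le_comb_left _ x y))
        obtain ⟨g, hg, hg'⟩ := ihy fun hc => h (hc.trans (le_comb_right _ x y))
        exact ⟨_, hf.comb hg, fun i => hcl i _ (hf' i) _ (hg' i)⟩
      | @attach x c hx hc ihx =>
        intro h
        by_cases hbc : b ≤ c
        · obtain ⟨f, hf, hfu⟩ := hπu x hx fun hσx => h (attach_mono L hσx hbc)
          refine ⟨_, hf.inl.attach (Coloured.unit c).inr.inr, ?_⟩
          rintro (i | i | i)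
          · exact (attach_empty_right L (f i)).symm ▸ hfu i
          · exact (attach_empty_right L emptyPerm).symm ▸ emptyPerm_mem_wordClass _
          · exact (attach_empty_left L c).symm ▸ Gen.of_mem hc
        · obtain ⟨f, hf, hfu⟩ := ihx fun hσx => h (hσx.trans (le_attach_left L x c))
          obtain ⟨g, hg, hgv⟩ := hπv c hc hbc
          refine ⟨_, hf.attach hg.inl.inr, ?_⟩
          rintro (i | i | i)
          · exact (attach_empty_right L _).symm ▸ hfu (Sum.inl i)
          · exact Gen.attach (hfu (Sum.inr (Sum.inl i))) (hgv i)
          · exact (attach_empty_right L _).symm ▸ hfu (Sum.inr (Sum.inr i))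
  | @join σ₁ σ₂ hbr _ _ ih₁ ih₂ =>
    obtain ⟨ι, hι, u, hu, hu', hπu⟩ := ih₁
    obtain ⟨κ, hκ, v, hv, hv', hπv⟩ := ih₂
    refine ⟨ι ⊕ (κ ⊕ Unit), inferInstance, Sum.elim u (Sum.elim v
      fun _ => ⟨!L.s, false, false⟩ :: ⟨L.s, false, false⟩ :: w), ?_, ?_, fun π hπ h => ?_⟩
    · rintro (i | i | i)
      · exact hu i
      · exact hv i
      · simp only [Sum.elim_inr, weight, cond_false]
        omega
    · rintro (i | i | i)
      · exact hu' i
      · exact hv' i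
      · exact hclosed _
    -- The last colour class is built by attaching only; this persists in a join as one of the two
    -- parts does not use the last colour.
    suffices hmain : ∃ f : ι ⊕ (κ ⊕ Unit) → Permutation, Coloured π f ∧
        (∀ i, f (Sum.inl i) ∈ wordClass (u i)) ∧
        (∀ i, f (Sum.inr (Sum.inl i)) ∈ wordClass (v i)) ∧
        Gen ⟨L.s, false, false⟩ (wordClass w) (f (Sum.inr (Sum.inr ()))) by
      obtain ⟨f, hf, hfu, hfv, hfw⟩ := hmain
      refine ⟨f, hf, ?_⟩
      rintro (i | i | i)
      · exact hfu i
      · exact hfv i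
      · exact Gen.of_mem hfw
    induction hπ with
    | empty =>
      exact ⟨_, Coloured.empty, fun i => emptyPerm_mem_wordClass _,
        fun i => emptyPerm_mem_wordClass _, .empty⟩
    | @join x y _ hx hy ihx ihy =>
      rcases not_le_or_not_le_of_comb h with h₁ | h₂
      · obtain ⟨f, hf, hfu⟩ := hπu x hx h₁
        obtain ⟨g, hg, hgu, hgv, hgw⟩ := ihy fun hc => h (hc.trans (le_comb_right _ x y))
        exact ⟨_, hf.inl.comb hg, fun i => hu' i _ (hfu i) _ (hgu i),
          fun i => (comb_empty_left _ _).symm ▸ hgv i, (comb_empty_left _ _).symm ▸ hgw⟩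
      · obtain ⟨f, hf, hfv⟩ := hπv y hy h₂
        obtain ⟨g, hg, hgu, hgv, hgw⟩ := ihx fun hc => h (hc.trans (le_comb_left _ x y))
        exact ⟨_, hg.comb hf.inl.inr, fun i => (comb_empty_right _ _).symm ▸ hgu i,
          fun i => hv' i _ (hgv i) _ (hfv i), (comb_empty_right _ _).symm ▸ hgw⟩
    | @attach x c _ hc ihx =>
      obtain ⟨f, hf, hfu, hfv, hfw⟩ := ihx fun hσx => h (hσx.trans (le_attach_left L x c))
      refine ⟨_, hf.attach (Coloured.unit c).inr.inr, fun i => ?_, fun i => ?_, ?_⟩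
      · exact (attach_empty_right L _).symm ▸ hfu i
      · exact (attach_empty_right L _).symm ▸ hfv i
      · change Gen _ _ (PermPattern.attach L (f (Sum.inr (Sum.inr ()))) c)
        have hc' : Gen ⟨L.s, false, false⟩ (wordClass w) c := Gen.of_mem hc
        unfold PermPattern.attach
        cases L.left
        · exact hfw.comb rfl hc'
        · exact hc'.comb rfl hfw

theorem exists_splits_of_mem_wordClass (w : List Letter) :
    ∀ σ ∈ wordClass w, ∃ (ι : Type) (_ : Finite ι) (v : ι → List Letter),
      (∀ i, weight (v i) < weight w) ∧ ∀ π ∈ wordClass w, ¬ σ ≤ π → Splits v π := by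
  induction w with
  | nil =>
    intro σ (hσ : σ.size ≤ 1)
    refine ⟨Empty, inferInstance, Empty.elim, fun i => i.elim, fun π (hπ : π.size ≤ 1) h => ?_⟩
    obtain rfl : π = emptyPerm := by
      refine eq_emptyPerm_of_size (Nat.eq_zero_of_not_pos fun hpos => h ?_)
      exact (le_onePerm hσ).trans (onePerm_le hpos)
    exact ⟨_, Coloured.empty, fun i => i.elim⟩
  | cons L w ih =>
    intro σ hσ
    cases hL : L.br
    · obtain ⟨ι, hι, v, hv, h⟩ := Gen.exists_splits_of_br_eq_false hL ih hσ
      exact ⟨ι, hι, v, by simpa [weight, hL] using hv, h⟩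
    · obtain ⟨ι, hι, v, hv, -, h⟩ := Gen.exists_splits_of_br_eq_true hL ih hσ
      exact ⟨ι, hι, v, by simpa [weight, hL] using hv, h⟩

/-- The members of a representable class that lie in a class `X` split into finitely many
representable subclasses of `X`. -/
theorem exists_splits_inter {X : Set Permutation} (hX : IsPermClass X) (w : List Letter) :
    ∃ (ι : Type) (_ : Finite ι) (v : ι → List Letter), (∀ i, wordClass (v i) ⊆ X) ∧
      ∀ π ∈ X, π ∈ wordClass w → Splits v π := by
  induction hn : weight w using Nat.strong_induction_on generalizing w with | _ n ih
  subst hn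
  by_cases hw : wordClass w ⊆ X
  · exact ⟨Unit, inferInstance, fun _ => w, fun _ => hw,
      fun π _ hπ => ⟨_, Coloured.unit π, fun _ => hπ⟩⟩
  · obtain ⟨σ, hσ, hσX⟩ := Set.not_subset.1 hw
    obtain ⟨ι, hι, v, hv, hsplit⟩ := exists_splits_of_mem_wordClass w σ hσ
    choose κ hκ u hu hsplit' using fun i => ih _ (hv i) (v i) rfl
    refine ⟨Σ i, κ i, inferInstance, fun k => u k.1 k.2, fun k => hu k.1 k.2, fun π hπ hπw => ?_⟩
    obtain ⟨f, hf, hfv⟩ := hsplit π hπw fun h => hσX (hX h hπ)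
    choose g hg hgu using fun i => hsplit' i (f i) (hX (hf.le i) hπ) (hfv i)
    exact ⟨_, hf.sigma hg, fun k => hgu k.1 k.2⟩

/-- A proper subclass `X` of the class of separable permutations splits into finitely many
representable subclasses of `X`. -/
theorem exists_splits_of_ssubset_sep {X : Set Permutation} (hX : IsPermClass X) (hXS : X ⊂ Sep) :
    ∃ (ι : Type) (_ : Finite ι) (v : ι → List Letter), (∀ i, wordClass (v i) ⊆ X) ∧
      ∀ π ∈ X, Splits v π := by
  obtain ⟨σ, hσ, hσX⟩ := Set.exists_of_ssubset hXS
  obtain ⟨ι, hι, w, hw⟩ := IsSeparable.exists_splits hσ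
  choose κ hκ u hu hsplit using fun i => exists_splits_inter hX (w i)
  refine ⟨Σ i, κ i, inferInstance, fun k => u k.1 k.2, fun k => hu k.1 k.2, fun π hπ => ?_⟩
  obtain ⟨f, hf, hfw⟩ := hw π (hXS.1 hπ) (Or.inl fun h => hσX (hX h hπ))
  choose g hg hgu using fun i => hsplit i (f i) (hX (hf.le i) hπ) (hfw i)
  exact ⟨_, hf.sigma hg, fun k => hgu k.1 k.2⟩

/-! ### Minimal uncovered classes -/

theorem finite_minimalUncovered (A : Set (Set Permutation)) : (minimalUncovered A).Finite := by
  by_contra hinf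
  let e := Set.Infinite.natEmbedding _ hinf
  have he : ∀ n, Minimal (fun R => Representable R ∧ ∀ C ∈ A, ¬ R ⊆ C) (e n : Set Permutation) :=
    fun n => (e n).2
  choose w hw using fun n => representable_iff.1 (he n).prop.1
  obtain ⟨m, n, hmn, hsub⟩ := wellQuasiOrdered_wordClass w
  rw [← hw, ← hw] at hsub
  have heq : (e m : Set Permutation) = e n :=
    hsub.antisymm ((he n).le_of_le (he m).prop hsub)
  exact hmn.ne (e.injective (Subtype.ext heq))

theorem exists_minimalUncovered_subset {A : Set (Set Permutation)} {w : List Letter}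
    (hw : ∀ C ∈ A, ¬ wordClass w ⊆ C) : ∃ R ∈ minimalUncovered A, R ⊆ wordClass w := by
  have : IsPreorder (List Letter) fun v w => wordClass v ⊆ wordClass w :=
    { refl := fun _ => le_rfl, trans := fun _ _ _ h h' => h.trans h' }
  obtain ⟨v, ⟨hv, hvw⟩, hmin⟩ := wellQuasiOrdered_wordClass.wellFounded.has_min
    {v | (∀ C ∈ A, ¬ wordClass v ⊆ C) ∧ wordClass v ⊆ wordClass w} ⟨w, hw, le_rfl⟩
  refine ⟨wordClass v, ⟨⟨representable_iff.2 ⟨v, rfl⟩, hv⟩, ?_⟩, hvw⟩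
  rintro R ⟨hR, hRA⟩ hRv
  obtain ⟨u, rfl⟩ := representable_iff.1 hR
  by_contra hvu
  exact hmin u ⟨hRA, hRv.trans hvw⟩ ⟨hRv, hvu⟩

end PermPattern

theorem mainTheorem3 (A : Set (Set PermPattern.Permutation))
    (hA : ∀ C ∈ A, PermPattern.Representable C) :
    (PermPattern.minimalUncovered A).Finite ∧
      ∀ X : Set PermPattern.Permutation, PermPattern.IsPermClass X → X ⊂ PermPattern.Sep →
        (PermPattern.Splittable A X ↔ ∀ R ∈ PermPattern.minimalUncovered A, ¬ R ⊆ X) := by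
  refine ⟨PermPattern.finite_minimalUncovered A, fun X hX hXS => ⟨?_, fun h => ?_⟩⟩
  · rintro ⟨k, C, hC, hXC⟩ R ⟨⟨hR, hRA⟩, -⟩ hRX
    obtain ⟨w, rfl⟩ := PermPattern.representable_iff.1 hR
    obtain ⟨i, hi⟩ := PermPattern.exists_subset_of_subset_merge (C := C) (fun i => by
      obtain ⟨v, hv⟩ := PermPattern.representable_iff.1 (hA _ (hC i))
      rw [hv]
      exact PermPattern.isLowerSet_wordClass v) (hRX.trans hXC)
    exact hRA _ (hC i) hi
  · obtain ⟨ι, hι, v, hv, hsplit⟩ := PermPattern.exists_splits_of_ssubset_sep hX hXS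
    have hcover : ∀ i, ∃ C ∈ A, PermPattern.wordClass (v i) ⊆ C := by
      intro i
      by_contra! hcon
      obtain ⟨R, hR, hRv⟩ := PermPattern.exists_minimalUncovered_subset hcon
      exact h R hR (hRv.trans (hv i))
    choose C hCA hvC using hcover
    obtain ⟨k, ⟨e⟩⟩ := Finite.exists_equiv_fin ι
    refine ⟨k, C ∘ e.symm, fun i => hCA _, fun π hπ => ?_⟩
    obtain ⟨f, hf, hfv⟩ := hsplit π hπ
    exact PermPattern.mem_merge_iff.2 ⟨f ∘ e.symm, hf.comp_symm e, fun i => hvC _ (hfv _)⟩
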